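/- Let $\{a,b\}^*$ be the set of words on two letters. A word $u$ is \emph{primitive} if it has exponent $1$, where the exponent of a word is the largest integer $d\ge 1$ such that the word is the concatenation $v^d$ of $d$ copies of some word $v$ (in particular a primitive word is non-empty). For $n\geq 1$ let $\mathbf a,\mathbf b:[n]\to[n]$ be independent uniformly random functions on $[n]=\{1,\dots,n\}$. For a word $w=w_1w_2\cdots w_k$ let $\mathbf w=\phi_{w_k}\circ\cdots\circ\phi_{w_2}\circ\phi_{w_1}$, where $\phi_a=\mathbf a$ and $\phi_b=\mathbf b$. A cycle of length $\ell\ge 1$ of a function $f:[n]\to[n]$ is a sequence $(i_1,\dots,i_\ell)$ of distinct elements of $[n]$, considered up to rotation, with $f(i_j)=i_{j+1}$ for $1\le j\le \ell$, where $i_{\ell+1}=i_1$; let $C_n^\ell(f)$ be the number of cycles of length $\ell$ of $f$. Let $Z_1,Z_2,\dots$ be independent random variables with $Z_\ell\sim\mathrm{Poisson}(1/\ell)$. Let $u$ be a primitive word and $w=u^d$ for some integer $d\ge1$. Then for any fixed integer $L\ge1$, as $n\to\infty$, $$\bigl(C_n^1(\mathbf u),\dots,C_n^L(\mathbf u)\bigr)\xrightarrow{(d)}(Z_1,\dots,Z_L)$$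 and $$\bigl(C_n^1(\mathbf w),\dots,C_n^L(\mathbf w)\bigr)\xrightarrow{(d)}\Psi(Z_1,\dots,Z_{dL}),$$ where $\Psi(x_1,\dots,x_{dL})=(y_1,\dots,y_L)$ with $$y_i=\sum_{\substack{1\le c\le d,\; c\mid d\\ \gcd(i,c)=1}}\frac dc\,x_{di/c}\qquad(1\le i\le L).$$ In both cases the convergence also holds in the sense of moments: all joint moments of the vector on the left converge to the corresponding (finite) joint moments of the vector on the right. -/

import Mathlib

open MeasureTheory ProbabilityTheory Filter Topology

namespace RandomWordMap

/-- The two-letter alphabet `{a, b}`. -/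
inductive Letter
  | a
  | b

/-- Words on `{a, b}`: the free monoid, so that `u ^ d` is the concatenation of `d` copies
of `u`. -/
abbrev Word := FreeMonoid Letter

/-- `d` is the exponent of the word `w`: the largest integer `d ≥ 1` such that `w = u ^ d` for
some word `u`. (The empty word has no exponent.) -/
def HasExponent (w : Word) (d : ℕ) : Prop :=
  IsGreatest {e : ℕ | 1 ≤ e ∧ ∃ u : Word, w = u ^ e} d

/-- A word is primitive if it has exponent `1`. -/
def IsPrimitive (u : Word) : Prop := HasExponent u 1

/-- The map attached to a letter: `φ_a = f`, `φ_b = g`. -/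
def letterMap {α : Type*} (f g : α → α) : Letter → α → α
  | Letter.a => f
  | Letter.b => g

/-- The map `φ_{w_k} ∘ ⋯ ∘ φ_{w_2} ∘ φ_{w_1}` attached to the word `w = w_1 w_2 ⋯ w_k`
(the first letter acts first). -/
def wordMap {α : Type*} (f g : α → α) (w : Word) : α → α :=
  fun x => (FreeMonoid.toList w).foldl (fun y l => letterMap f g l y) x

/-- The number of cycles of length `ℓ` of `f`: sequences `(i_1, …, i_ℓ)` of distinct elements,
up to rotation, with `f i_j = i_{j+1}` for all `j`, indices being taken cyclically. -/
noncomputable def cycleCount {n : ℕ} (f : Fin n → Fin n) (ℓ : ℕ) : ℕ :=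
  {c : Cycle (Fin n) | c.Nodup ∧ c.length = ℓ ∧ c.Chain (fun i j => f i = j)}.ncard

/-- The vector of the numbers of cycles of lengths `1, …, L` of `f`. -/
noncomputable def cycleVector {n : ℕ} (f : Fin n → Fin n) (L : ℕ) : Finset.Icc 1 L → ℕ :=
  fun i => cycleCount f i

/-- For `c ∣ d` with `d ≠ 0` and `1 ≤ i ≤ L`, one has `1 ≤ d i / c ≤ d L`. -/
theorem index_mem {d L i c : ℕ} (hi : i ∈ Finset.Icc 1 L)
    (hc : c ∈ d.divisors.filter (fun c => Nat.gcd i c = 1)) :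
    d * i / c ∈ Finset.Icc 1 (d * L) := by
  have hc' := (Finset.mem_filter.mp hc).1
  have hcd : c ∣ d := Nat.dvd_of_mem_divisors hc'
  have hc0 : 0 < c := Nat.pos_of_mem_divisors hc'
  have hd0 : 0 < d := Nat.pos_of_ne_zero (Nat.mem_divisors.mp hc').2
  obtain ⟨h1, h2⟩ := Finset.mem_Icc.mp hi
  refine Finset.mem_Icc.mpr ⟨?_, ?_⟩
  · refine (Nat.one_le_div_iff hc0).mpr ?_
    exact (Nat.le_of_dvd hd0 hcd).trans (Nat.le_mul_of_pos_right d h1)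
  · exact (Nat.div_le_self _ _).trans (Nat.mul_le_mul_left d h2)

/-- The linear map `Ψ (x_1, …, x_{dL}) = (y_1, …, y_L)`, where `y_i` is the sum of
`(d / c) x_{d i / c}` over the divisors `c` of `d` with `gcd (i, c) = 1`. Both quotients are
exact. -/
def Psi (d L : ℕ) (x : Finset.Icc 1 (d * L) → ℕ) : Finset.Icc 1 L → ℕ :=
  fun i => ∑ c ∈ (d.divisors.filter (fun c => Nat.gcd (i : ℕ) c = 1)).attach,
    (d / (c : ℕ)) * x ⟨d * (i : ℕ) / (c : ℕ), index_mem i.2 c.2⟩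

/-- Convergence of all joint moments of random vectors with values in `ℕ^ι` (the moments being
finite). -/
def TendstoInMoments {ι : Type*} [Fintype ι] {Ω : ℕ → Type*} [∀ n, MeasurableSpace (Ω n)]
    (X : (n : ℕ) → Ω n → ι → ℕ) (μ : (n : ℕ) → Measure (Ω n))
    {Ω' : Type*} [MeasurableSpace Ω'] (Y : Ω' → ι → ℕ) (μ' : Measure Ω') : Prop :=
  ∀ r : ι → ℕ,
    (∀ n, Integrable (fun ω => ∏ i, (X n ω i : ℝ) ^ r i) (μ n)) ∧
    Integrable (fun ω => ∏ i, (Y ω i : ℝ) ^ r i) μ' ∧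
    Tendsto (fun n => ∫ ω, ∏ i, (X n ω i : ℝ) ^ r i ∂(μ n)) atTop
      (𝓝 (∫ ω, ∏ i, (Y ω i : ℝ) ^ r i ∂μ'))

end RandomWordMap

/-! Independent Poisson variables of means `1/ℓ` have joint factorial moments `∏ (1/ℓ)^(r ℓ)`, so
the core is to show that the joint factorial moments of the cycle counts of a primitive `u` converge
to these. Multiplied by `∏ ℓ^(r ℓ)`, the product of falling factorials counts families of points of
prescribed periods on distinct cycles (`card_isCycleFamily`). Following the `k` letters of `u` one
at a time turns a family into a labelled configuration: a map `y` on the disjoint union `T` of the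
cyclic groups `ZMod (k * ℓ i)`, whose steps obey the letter maps and which is injective on the
positions where a copy of `u` begins (`card_isCycleFamily_eq_card_configurations`). The expected
number of configurations must then tend to `1`.

A map `y` with `v` values and `e` distinct (letter, point) pairs is realised with probability at
most `n^(-e)`, and there are `O(n^v)` such maps. Injective maps contribute the falling factorial of
`n` of order `|T|` over `n^|T|`, which tends to `1`. Non-injective ones have `e ≥ v + 1`
(`card_image_lt_of_not_injective`) and contribute `O(1/n)`. Primitivity enters here: if `e = v`, two
positions carrying the same point read the same letters forever, hence agree modulo `k` since no
proper rotation fixes `u`, hence reach a beginning of `u` together, against injectivity there.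

Stirling numbers pass from factorial moments to moments, and exponential moments of the Poisson
limit give convergence in distribution through Taylor expansion of characteristic functions. For `w
= u ^ d` the map is a `d`-th iterate, whose cycle counts are exactly `Psi` of those of `u`
(`cycleVector_iterate`); both convergences pass through `Psi`. -/

namespace RandomWordMap

/-! ### Primitive words and their rotations -/

/-- Two commuting words are powers of a common word. -/
theorem exists_eq_pow_of_append_comm {α : Type*} (p q : List α) (h : p ++ q = q ++ p) :
    ∃ (v : FreeMonoid α) (i j : ℕ), FreeMonoid.ofList p = v ^ i ∧ FreeMonoid.ofList q = v ^ j := by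
  induction hN : p.length + q.length using Nat.strong_induction_on generalizing p q with
  | _ N ih =>
    wlog hle : p.length ≤ q.length generalizing p q
    · obtain ⟨v, i, j, h1, h2⟩ := this q p h.symm (by omega) (by omega)
      exact ⟨v, j, i, h2, h1⟩
    rcases p.eq_nil_or_concat with rfl | ⟨p', a, rfl⟩
    · exact ⟨FreeMonoid.ofList q, 0, 1, by simp, by simp⟩
    · set p := p'.concat a
      have hp : 0 < p.length := by simp [p]
      -- Both words are prefixes of `q ++ p`, so the shorter one is a prefix of the longer;
      -- cancelling it leaves a shorter commuting pair.
      obtain ⟨q', rfl⟩ : p <+: q := by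
        have h1 : p <+: q ++ p := ⟨q, h⟩
        exact List.prefix_of_prefix_length_le h1 (List.prefix_append q p) hle
      have h' : p ++ q' = q' ++ p := by simpa [List.append_assoc] using h
      obtain ⟨v, i, j, h1, h2⟩ := ih (p.length + q'.length)
        (by rw [List.length_append] at hN; omega) p q' h' rfl
      exact ⟨v, i, i + j, h1, by rw [FreeMonoid.ofList_append, h1, h2, pow_add]⟩

theorem IsPrimitive.toList_ne_nil {u : Word} (hu : IsPrimitive u) :
    FreeMonoid.toList u ≠ [] := by
  intro h
  have : u = 1 := h
  subst this
  have := hu.2 (show 2 ∈ _ from ⟨by norm_num, 1, by simp⟩)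
  omega

/-- A rotation fixing the word splits it into two non-empty commuting factors, so the word is `v ^
(i + j)` with `i, j ≥ 1`, of exponent at least `2`. -/
theorem IsPrimitive.rotate_ne {u : Word} (hu : IsPrimitive u) {r : ℕ} (h0 : 0 < r)
    (hr : r < (FreeMonoid.toList u).length) :
    (FreeMonoid.toList u).rotate r ≠ FreeMonoid.toList u := by
  intro h
  set l := FreeMonoid.toList u with hl
  rw [List.rotate_eq_drop_append_take hr.le] at h
  have hcomm : l.take r ++ l.drop r = l.drop r ++ l.take r := by
    rw [h, List.take_append_drop]
  obtain ⟨v, i, j, h1, h2⟩ := exists_eq_pow_of_append_comm _ _ hcomm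
  have hi : i ≠ 0 := by
    rintro rfl
    have h3 : l.take r = [] := h1
    have := congrArg List.length h3
    rw [List.length_take, List.length_nil] at this
    omega
  have hj : j ≠ 0 := by
    rintro rfl
    have h3 : l.drop r = [] := h2
    have := congrArg List.length h3
    rw [List.length_drop, List.length_nil] at this
    omega
  have huv : u = v ^ (i + j) := by
    rw [pow_add, ← h1, ← h2, ← FreeMonoid.ofList_append, List.take_append_drop]
    rfl
  have := hu.2 (show i + j ∈ _ from ⟨by omega, v, huv⟩)
  omega

/-- The letters of a primitive word, read cyclically, have no period smaller than the length. -/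
theorem IsPrimitive.cyclic_letters_injective {u : Word} (hu : IsPrimitive u) {k : ℕ} [NeZero k]
    (lam : ZMod k → Letter) (hk : (FreeMonoid.toList u).length = k)
    (hlam : ∀ (m : ℕ) (hm : m < k), lam m = (FreeMonoid.toList u)[m]'(hk ▸ hm))
    {s t : ZMod k} (hst : ∀ m : ℕ, lam (s + m) = lam (t + m)) : s = t := by
  -- Equal readings from `s` and `t` make `t - s` a period of `lam`; if non-zero, its representative
  -- is a proper rotation fixing `u`.
  have hall : ∀ x : ZMod k, lam (x + (t - s)) = lam x := by
    intro x
    have := hst (x - s).val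
    rw [ZMod.natCast_zmod_val] at this
    rw [show x + (t - s) = t + (x - s) by ring, ← this]
    congr 1; ring
  set r := (t - s).val with hr
  have hrk : r < k := ZMod.val_lt _
  have hrc : ((r : ℕ) : ZMod k) = t - s := ZMod.natCast_zmod_val _
  rcases Nat.eq_zero_or_pos r with h0 | hpos
  · rw [h0, Nat.cast_zero] at hrc
    exact (sub_eq_zero.mp hrc.symm).symm
  · exfalso
    refine hu.rotate_ne hpos (hk ▸ hrk) (List.ext_getElem (by simp) fun m h1 h2 => ?_)
    rw [List.getElem_rotate]
    have hm : m < k := hk ▸ h2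
    have e1 := hlam ((m + r) % k) (Nat.mod_lt _ (Nat.pos_of_neZero k))
    have e2 := hlam m hm
    have e3 := hall m
    rw [← hrc, ← Nat.cast_add, ← ZMod.natCast_mod, e1, e2] at e3
    rw [← e3]
    simp only [hk]

/-! ### Counting labelled configurations -/

open Finset in
/-- The number of maps with prescribed values on the range of `c`. -/
theorem card_extensions_mul {T α β : Type*} [Fintype T] [Fintype α] [Fintype β] [DecidableEq α]
    [DecidableEq β] (c : T → α) (e : T → β) (F₀ : α → β) (h₀ : ∀ t, F₀ (c t) = e t) :
    #{F : α → β | ∀ t, F (c t) = e t} * Fintype.card β ^ #(univ.image c) =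
      Fintype.card β ^ Fintype.card α := by
  have hset : ({F : α → β | ∀ t, F (c t) = e t} : Finset (α → β)) =
      Fintype.piFinset (fun a => if a ∈ univ.image c then {F₀ a} else univ) := by
    ext F
    simp only [mem_filter, mem_univ, true_and, Fintype.mem_piFinset]
    constructor
    · intro h a
      split_ifs with ha
      · obtain ⟨t, -, rfl⟩ := mem_image.mp ha
        simp [h, h₀]
      · simp
    · intro h t
      have := h (c t)
      rw [if_pos (mem_image_of_mem c (mem_univ t)), mem_singleton] at this
      rw [this, h₀]
  have hcard : ∀ a, #(if a ∈ univ.image c then {F₀ a} else (univ : Finset β)) =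
      if a ∈ univ.image c then 1 else Fintype.card β := by
    intro a; split_ifs <;> simp
  rw [hset, Fintype.card_piFinset]
  simp_rw [hcard]
  rw [prod_ite, prod_const_one, one_mul, prod_const, ← pow_add]
  congr 1
  rw [← card_univ, ← card_filter_add_card_filter_not (s := univ) (· ∈ univ.image c), add_comm]
  simp

open Finset in
theorem card_extensions_mul_le {T α β : Type*} [Fintype T] [Fintype α] [Fintype β] [DecidableEq α]
    [DecidableEq β] (c : T → α) (e : T → β) :
    #{F : α → β | ∀ t, F (c t) = e t} * Fintype.card β ^ #(univ.image c) ≤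
      Fintype.card β ^ Fintype.card α := by
  by_cases h : ∃ F₀ : α → β, ∀ t, F₀ (c t) = e t
  · obtain ⟨F₀, h₀⟩ := h
    exact (card_extensions_mul c e F₀ h₀).le
  · push Not at h
    rw [filter_eq_empty_iff.mpr]
    · simp
    · intro F _ hF
      obtain ⟨t, ht⟩ := h F
      exact ht (hF t)

open Finset in
/-- There are at most `n ^ v * |T| ^ |T|` maps from `T` to an `n`-set with range of size `v`. -/
theorem card_filter_card_image_le (T β : Type*) [Fintype T] [DecidableEq T] [Fintype β]
    [DecidableEq β] (v : ℕ) (hv : v ≤ Fintype.card T) :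
    #{y : T → β | #(univ.image y) = v} ≤
      Fintype.card β ^ v * Fintype.card T ^ Fintype.card T := by
  have hsub : ({y : T → β | #(univ.image y) = v} : Finset (T → β)) ⊆
      (powersetCard v (univ : Finset β)).biUnion (fun A => Fintype.piFinset (fun _ : T => A)) := by
    intro y hy
    simp only [mem_filter, mem_univ, true_and] at hy
    simp only [mem_biUnion, mem_powersetCard, subset_univ, true_and, Fintype.mem_piFinset]
    exact ⟨_, hy, fun t => mem_image_of_mem y (mem_univ t)⟩
  calc _ ≤ _ := card_le_card hsub
    _ ≤ ∑ A ∈ powersetCard v (univ : Finset β), #(Fintype.piFinset (fun _ : T => A)) :=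
        card_biUnion_le
    _ = ∑ A ∈ powersetCard v (univ : Finset β), v ^ Fintype.card T := by
        refine sum_congr rfl fun A hA => ?_
        rw [Fintype.card_piFinset, prod_const, (mem_powersetCard.mp hA).2, card_univ]
    _ = (Fintype.card β).choose v * v ^ Fintype.card T := by
        rw [sum_const, card_powersetCard, card_univ, smul_eq_mul]
    _ ≤ _ := Nat.mul_le_mul (Nat.choose_le_pow _ _) (Nat.pow_le_pow_left hv _)

open Finset in
/-- A non-injective labelled configuration uses more pairs (label, point) than points. -/
theorem card_image_lt_of_not_injective {T Λ β : Type*} [Fintype T] [DecidableEq Λ]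
    [DecidableEq β] {tau : T → T}
    (htau : Function.Injective tau) {lam : T → Λ} {S : Set T}
    (hsep : ∀ t t', (∀ m, lam (tau^[m] t) = lam (tau^[m] t')) → t ≠ t' →
      ∃ m, tau^[m] t ∈ S ∧ tau^[m] t' ∈ S)
    (F : Λ × β → β) (y : T → β) (hy : Set.InjOn y S) (hF : ∀ t, F (lam t, y t) = y (tau t))
    (hni : ¬ Function.Injective y) :
    #(univ.image y) + 1 ≤ #(univ.image fun t => (lam t, y t)) := by
  -- Points are the second projections of the pairs. If the two counts agreed, a point would
  -- determine its label and hence, through `F`, its successor.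
  have himg : univ.image y = (univ.image fun t => (lam t, y t)).image Prod.snd := by
    rw [image_image]; rfl
  rw [Nat.succ_le_iff, himg]
  refine lt_of_le_of_ne card_image_le fun heq => hni ?_
  have hinj := card_image_iff.mp heq
  have hstep : ∀ t t', y t = y t' → lam t = lam t' ∧ y (tau t) = y (tau t') := by
    intro t t' h
    have h1 := hinj (mem_coe.mpr (mem_image_of_mem (fun t => (lam t, y t)) (mem_univ t)))
      (mem_coe.mpr (mem_image_of_mem (fun t => (lam t, y t)) (mem_univ t'))) h
    have h2 : lam t = lam t' := congrArg Prod.fst h1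
    exact ⟨h2, by rw [← hF, ← hF, h2, h]⟩
  intro t t' h
  by_contra hne
  have hall : ∀ m, y (tau^[m] t) = y (tau^[m] t') := by
    intro m
    induction m with
    | zero => exact h
    | succ m ih =>
      rw [Function.iterate_succ_apply', Function.iterate_succ_apply']
      exact (hstep _ _ ih).2
  -- The two positions carry equal points and labels forever, so they meet `S` at a common time,
  -- where `y` is injective.
  obtain ⟨m, h1, h2⟩ := hsep t t' (fun m => (hstep _ _ (hall m)).1) hne
  exact hne (htau.iterate m (hy h1 h2 (hall m)))

open Finset in
/-- The expected number of labelled configurations tends to `1`. -/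
theorem tendsto_sum_card_configurations {T Λ : Type*} [Fintype T] [DecidableEq T]
    [Fintype Λ] [DecidableEq Λ] {tau : T → T}
    (htau : Function.Injective tau) {lam : T → Λ} {S : Set T}
    (hsep : ∀ t t', (∀ m, lam (tau^[m] t) = lam (tau^[m] t')) → t ≠ t' →
      ∃ m, tau^[m] t ∈ S ∧ tau^[m] t' ∈ S) [∀ n, DecidablePred fun y : T → Fin n => Set.InjOn y S] :
    Tendsto (fun n : ℕ => (∑ F : Λ × Fin n → Fin n,
      (#{y : T → Fin n | Set.InjOn y S ∧ ∀ t, F (lam t, y t) = y (tau t)} : ℝ)) /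
        (n : ℝ) ^ (Fintype.card Λ * n)) atTop (𝓝 1) := by
  classical
  set q := Fintype.card T with hq
  set w : (n : ℕ) → (T → Fin n) → ℝ := fun n y =>
    (#{F : Λ × Fin n → Fin n | ∀ t, F (lam t, y t) = y (tau t)} : ℝ) /
      (n : ℝ) ^ (Fintype.card Λ * n) with hw
  have hsplit : ∀ n : ℕ, (∑ F : Λ × Fin n → Fin n,
      (#{y : T → Fin n | Set.InjOn y S ∧ ∀ t, F (lam t, y t) = y (tau t)} : ℝ)) /
        (n : ℝ) ^ (Fintype.card Λ * n) =
      ∑ y : T → Fin n with Function.Injective y, w n y +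
      ∑ y : T → Fin n with Set.InjOn y S ∧ ¬ Function.Injective y, w n y := by
    intro n
    have h1 : ∑ F : Λ × Fin n → Fin n,
        #{y : T → Fin n | Set.InjOn y S ∧ ∀ t, F (lam t, y t) = y (tau t)} =
        ∑ y : T → Fin n with Set.InjOn y S,
          #{F : Λ × Fin n → Fin n | ∀ t, F (lam t, y t) = y (tau t)} := by
      have := sum_card_bipartiteAbove_eq_sum_card_bipartiteBelow
        (s := (univ : Finset (Λ × Fin n → Fin n)))
        (t := ({y : T → Fin n | Set.InjOn y S} : Finset _))
        (fun F y => ∀ t, F (lam t, y t) = y (tau t))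
      simpa only [bipartiteAbove, bipartiteBelow, filter_filter] using this
    rw [← Nat.cast_sum, h1, Nat.cast_sum, sum_div,
      ← sum_filter_add_sum_filter_not _ (fun y : T → Fin n => Function.Injective y),
      filter_filter, filter_filter]
    congr 2
    ext y
    simp only [mem_filter, mem_univ, true_and, and_iff_right_iff_imp]
    exact fun h => h.injOn
  -- An injective `y` imposes `q` constraints at distinct arguments, each satisfied with probability
  -- `1/n`.
  have hinj : ∀ n : ℕ, 0 < n → ∑ y : T → Fin n with Function.Injective y, w n y =
      (n.descFactorial q : ℝ) / (n : ℝ) ^ q := by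
    intro n hn
    have hn' : (n : ℝ) ≠ 0 := by positivity
    have : Nonempty (Fin n) := ⟨⟨0, hn⟩⟩
    have : ∀ y ∈ ({y : T → Fin n | Function.Injective y} : Finset _),
        w n y = 1 / (n : ℝ) ^ q := by
      intro y hy
      have hy' : Function.Injective y := (mem_filter.mp hy).2
      have hc : Function.Injective (fun t => (lam t, y t)) :=
        fun a b h => hy' (congrArg Prod.snd h)
      have h := card_extensions_mul (fun t => (lam t, y t)) (fun t => y (tau t))
        (Function.extend (fun t => (lam t, y t)) (fun t => y (tau t))
          (fun _ => Classical.arbitrary _)) (fun t => hc.extend_apply _ _ t)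
      rw [card_image_of_injective _ hc, card_univ, Fintype.card_prod, Fintype.card_fin] at h
      simp only [hw]
      rw [div_eq_div_iff (by positivity) (by positivity), one_mul]
      exact_mod_cast h
    rw [sum_congr rfl this, sum_const, nsmul_eq_mul, mul_one_div]
    congr 2
    have e := Fintype.card_congr (Equiv.subtypeInjectiveEquivEmbedding T (Fin n))
    rw [Fintype.card_embedding_eq, Fintype.card_fin, Fintype.card_subtype] at e
    exact e
  -- For each `v ≤ q` there are at most `n^v * q^q` maps with `v` values, each of weight at most
  -- `n^(-(v+1))`; summing over the `q + 1` values of `v` gives the constant.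
  have hnon : ∀ n : ℕ, 0 < n →
      ∑ y : T → Fin n with Set.InjOn y S ∧ ¬ Function.Injective y, w n y ≤
      ((q + 1 : ℕ) * (q : ℝ) ^ q) / n := by
    intro n hn
    have hn' : (0 : ℝ) < n := by positivity
    have hb : ∀ y ∈ ({y : T → Fin n | Set.InjOn y S ∧ ¬ Function.Injective y} : Finset _),
        w n y ≤ 1 / (n : ℝ) ^ (#(univ.image y) + 1) := by
      intro y hy
      obtain ⟨hyS, hyn⟩ := (mem_filter.mp hy).2
      simp only [hw]
      rw [div_le_div_iff₀ (by positivity) (by positivity), one_mul]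
      by_cases hex : ∃ F : Λ × Fin n → Fin n, ∀ t, F (lam t, y t) = y (tau t)
      · obtain ⟨F, hF⟩ := hex
        have h1 := card_image_lt_of_not_injective htau hsep F y hyS hF hyn
        have h2 := card_extensions_mul_le (fun t => (lam t, y t)) (fun t => y (tau t))
        rw [Fintype.card_prod, Fintype.card_fin] at h2
        have h3 := (Nat.mul_le_mul_left
          #{F : Λ × Fin n → Fin n | ∀ t, F (lam t, y t) = y (tau t)}
          (Nat.pow_le_pow_right hn h1)).trans h2
        exact_mod_cast h3
      · push Not at hex
        rw [filter_eq_empty_iff.mpr]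
        · simp only [card_empty, Nat.cast_zero, zero_mul]; positivity
        · intro F _ hF
          obtain ⟨t, ht⟩ := hex F
          exact ht (hF t)
    calc _ ≤ ∑ y : T → Fin n with Set.InjOn y S ∧ ¬ Function.Injective y,
          1 / (n : ℝ) ^ (#(univ.image y) + 1) := sum_le_sum hb
      _ ≤ ∑ y : T → Fin n, 1 / (n : ℝ) ^ (#(univ.image y) + 1) :=
          sum_le_sum_of_subset_of_nonneg (filter_subset _ _) fun _ _ _ => by positivity
      _ = ∑ v ∈ range (q + 1), ∑ y : T → Fin n with #(univ.image y) = v,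
          1 / (n : ℝ) ^ (#(univ.image y) + 1) := by
          refine (sum_fiberwise_of_maps_to (fun y _ => ?_) _).symm
          rw [mem_range, Nat.lt_succ_iff]
          exact card_image_le
      _ ≤ ∑ v ∈ range (q + 1), (q : ℝ) ^ q / n := by
          refine sum_le_sum fun v hv => ?_
          have hv' : v ≤ q := Nat.lt_succ_iff.mp (mem_range.mp hv)
          rw [sum_congr rfl (fun y hy => by rw [(mem_filter.mp hy).2]), sum_const, nsmul_eq_mul,
            mul_one_div, div_le_div_iff₀ (by positivity) hn']
          have := card_filter_card_image_le T (Fin n) v hv'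
          rw [Fintype.card_fin] at this
          have h2 := Nat.mul_le_mul_right n this
          have h3 : (#{y : T → Fin n | #(univ.image y) = v} : ℝ) * n ≤ n ^ v * q ^ q * n := by
            exact_mod_cast h2
          calc _ ≤ _ := h3
            _ = _ := by ring
      _ = _ := by rw [sum_const, card_range, nsmul_eq_mul]; ring
  have hlim1 : Tendsto (fun n : ℕ => (n.descFactorial q : ℝ) / (n : ℝ) ^ q) atTop (𝓝 1) := by
    have h := isEquivalent_descFactorial q
    rw [Asymptotics.isEquivalent_iff_tendsto_one] at h
    · exact h
    · filter_upwards [eventually_gt_atTop 0] with n hn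
      positivity
  have hlim2 : Tendsto (fun n : ℕ =>
      ∑ y : T → Fin n with Set.InjOn y S ∧ ¬ Function.Injective y, w n y) atTop (𝓝 0) := by
    refine squeeze_zero' (Eventually.of_forall fun n => sum_nonneg fun y _ => ?_) ?_
      (tendsto_const_div_atTop_nhds_zero_nat ((q + 1 : ℕ) * (q : ℝ) ^ q))
    · simp only [hw]; positivity
    · filter_upwards [eventually_gt_atTop 0] with n hn using hnon n hn
  have hlim := hlim1.add hlim2
  rw [add_zero] at hlim
  refine hlim.congr' ?_
  filter_upwards [eventually_gt_atTop 0] with n hn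
  rw [hsplit, hinj n hn]

/-! ### Cycles as periodic orbits -/

open Function

/-- Any entry of the cycle serves as `p`: the chain condition makes the entries its successive
iterates, and the absence of duplicates forces the minimal period to be the full length. -/
theorem exists_periodicOrbit_eq {α : Type*} {f : α → α} {c : Cycle α} (hc : c.Nodup) (hne : c ≠ Cycle.nil)
    (hch : c.Chain (fun i j => f i = j)) :
    ∃ p, minimalPeriod f p = c.length ∧ periodicOrbit f p = c := by
  induction c using Quotient.inductionOn' with
  | h l =>
  rcases l with _ | ⟨a, l⟩
  · exact absurd rfl hne
  change Cycle.Nodup ((a :: l : List α) : Cycle α) at hc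
  change Cycle.Chain _ ((a :: l : List α) : Cycle α) at hch
  change ∃ p, minimalPeriod f p = Cycle.length ((a :: l : List α) : Cycle α) ∧
    periodicOrbit f p = ((a :: l : List α) : Cycle α)
  rw [Cycle.nodup_coe_iff] at hc
  rw [Cycle.chain_coe_cons] at hch
  -- The list includes the closing copy of `a`, so that its last entry yields periodicity.
  have hget : ∀ i (hi : i < (a :: (l ++ [a])).length), (a :: (l ++ [a]))[i] = f^[i] a := by
    intro i
    induction i with
    | zero => intro _; rfl
    | succ i ih =>
      intro hi
      rw [iterate_succ_apply', ← ih (by omega)]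
      exact (List.isChain_iff_getElem.mp hch i hi).symm
  have hget' : ∀ i (hi : i < (a :: l).length), (a :: l)[i] = f^[i] a := by
    intro i hi
    rw [← hget i (by simp at hi ⊢; omega)]
    simp only [← List.cons_append]
    rw [List.getElem_append_left]
  have hlast : f^[(a :: l).length] a = a := by
    rw [← hget _ (by simp)]
    simp
  have hmin : minimalPeriod f a = (a :: l).length := by
    have hper : IsPeriodicPt f (a :: l).length a := hlast
    have hpos := hper.minimalPeriod_pos (by simp)
    refine le_antisymm (hper.minimalPeriod_le (by simp)) ?_
    by_contra! hlt
    have h0 : (a :: l)[minimalPeriod f a] = (a :: l)[0] := by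
      rw [hget', hget', iterate_minimalPeriod]; rfl
    have := (List.Nodup.getElem_inj_iff hc).mp h0
    omega
  refine ⟨a, hmin, ?_⟩
  rw [periodicOrbit_def, hmin]
  congr 1
  refine List.ext_getElem (by simp) fun i h1 h2 => ?_
  rw [hget' i h2, List.getElem_map, List.getElem_range]

theorem periodicOrbit_eq_iff {α : Type*} {f : α → α} {p q : α} (hp : p ∈ periodicPts f)
    (hq : q ∈ periodicPts f) : periodicOrbit f p = periodicOrbit f q ↔ ∃ m, f^[m] p = q := by
  constructor
  · intro h
    rw [← mem_periodicOrbit_iff hp, h]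
    exact self_mem_periodicOrbit hq
  · rintro ⟨m, rfl⟩
    exact (periodicOrbit_apply_iterate_eq hp m).symm

open Finset in
-- The points on the orbit of `p` are its iterates `f^[m] p` with `m < ℓ`, which are distinct by
-- minimality of the period.
theorem card_filter_periodicOrbit_eq {α : Type*} [Fintype α] [DecidableEq α]
    [DecidableEq (Cycle α)] {f : α → α} {ℓ : ℕ} (hℓ : 1 ≤ ℓ)
    {p : α} (hp : minimalPeriod f p = ℓ) :
    #{q | minimalPeriod f q = ℓ ∧ periodicOrbit f q = periodicOrbit f p} = ℓ := by
  have hpp : p ∈ periodicPts f := minimalPeriod_pos_iff_mem_periodicPts.mp (by omega)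
  have : ({q | minimalPeriod f q = ℓ ∧ periodicOrbit f q = periodicOrbit f p} : Finset α) =
      (range ℓ).image (fun m => f^[m] p) := by
    ext q
    simp only [mem_filter, mem_univ, true_and, mem_image, mem_range]
    constructor
    · rintro ⟨hq, h⟩
      have hqp : q ∈ periodicPts f := minimalPeriod_pos_iff_mem_periodicPts.mp (by omega)
      obtain ⟨m, rfl⟩ := (periodicOrbit_eq_iff hpp hqp).mp h.symm
      exact ⟨m % ℓ, Nat.mod_lt _ hℓ, by rw [← hp, iterate_mod_minimalPeriod_eq]⟩
    · rintro ⟨m, -, rfl⟩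
      exact ⟨by rw [minimalPeriod_apply_iterate hpp, hp], periodicOrbit_apply_iterate_eq hpp m⟩
  rw [this, card_image_of_injOn, card_range]
  intro a ha b hb hab
  rw [coe_range, ← hp] at ha hb
  exact iterate_injOn_Iio_minimalPeriod ha hb hab

open Finset in
theorem cycleCount_eq_card_image [∀ n, DecidableEq (Cycle (Fin n))] {n : ℕ} (f : Fin n → Fin n)
    {ℓ : ℕ} (hℓ : 1 ≤ ℓ) :
    cycleCount f ℓ = #(({p | minimalPeriod f p = ℓ} : Finset (Fin n)).image (periodicOrbit f)) := by
  rw [cycleCount, ← Set.ncard_coe_finset]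
  congr 1
  ext c
  simp only [Set.mem_ofPred_eq, coe_image, coe_filter, mem_univ, true_and, Set.mem_image]
  constructor
  · rintro ⟨h1, rfl, h3⟩
    have hne : c ≠ Cycle.nil := by rintro rfl; simp at hℓ
    exact exists_periodicOrbit_eq h1 hne h3
  · rintro ⟨p, hp, rfl⟩
    have hpp : p ∈ periodicPts f := minimalPeriod_pos_iff_mem_periodicPts.mp (by omega)
    refine ⟨nodup_periodicOrbit, by rw [periodicOrbit_length, hp], ?_⟩
    rw [periodicOrbit_chain' _ hpp]
    intro m
    rw [iterate_succ_apply']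

open Finset in
theorem cycleCount_mul_eq_card {n : ℕ} (f : Fin n → Fin n) {ℓ : ℕ} (hℓ : 1 ≤ ℓ) :
    cycleCount f ℓ * ℓ = #{p : Fin n | minimalPeriod f p = ℓ} := by
  classical
  rw [cycleCount_eq_card_image f hℓ]
  rw [card_eq_sum_card_image (periodicOrbit f) {p : Fin n | minimalPeriod f p = ℓ}]
  rw [sum_const_nat]
  intro c hc
  obtain ⟨p, hp, rfl⟩ := mem_image.mp hc
  rw [filter_filter]
  exact card_filter_periodicOrbit_eq hℓ (mem_filter.mp hp).2

open Finset in
/-- If all fibres of `g` on `A` have size `ℓ`, this counts the `r`-tuples of elements of `A` with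
distinct values under `g`. -/
theorem card_tuples_injective_comp {α β : Type*} [Fintype α] [DecidableEq α] [DecidableEq β]
    (A : Finset α) (g : α → β) {ℓ : ℕ} (hg : ∀ b ∈ A.image g, #{a ∈ A | g a = b} = ℓ) (r : ℕ)
    [DecidablePred fun q : Fin r → α => (∀ j, q j ∈ A) ∧ Injective (g ∘ q)] :
    #{q : Fin r → α | (∀ j, q j ∈ A) ∧ Injective (g ∘ q)} =
      (#(A.image g)).descFactorial r * ℓ ^ r := by
  classical
  have hset : ({q : Fin r → α | (∀ j, q j ∈ A) ∧ Injective (g ∘ q)} : Finset _) =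
      (univ : Finset (Fin r ↪ A.image g)).biUnion
        (fun e => Fintype.piFinset fun j => {a ∈ A | g a = e j}) := by
    ext q
    simp only [mem_filter, mem_univ, true_and, mem_biUnion, Fintype.mem_piFinset]
    constructor
    · rintro ⟨h1, h2⟩
      exact ⟨⟨fun j => ⟨g (q j), mem_image_of_mem g (h1 j)⟩,
        fun a b h => h2 (congrArg Subtype.val h)⟩, fun j => ⟨h1 j, rfl⟩⟩
    · rintro ⟨e, he⟩
      refine ⟨fun j => (he j).1, fun a b h => e.injective (Subtype.ext ?_)⟩
      rw [← (he a).2, ← (he b).2]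
      exact h
  rw [hset, card_biUnion]
  · have : ∀ e ∈ (univ : Finset (Fin r ↪ A.image g)),
        #(Fintype.piFinset fun j => {a ∈ A | g a = e j}) = ℓ ^ r := by
      intro e _
      rw [Fintype.card_piFinset, prod_congr rfl (fun j _ => hg _ (e j).2), prod_const, card_univ,
        Fintype.card_fin]
    rw [sum_congr rfl this, sum_const, card_univ, Fintype.card_embedding_eq, Fintype.card_coe,
      Fintype.card_fin, smul_eq_mul]
  · intro e _ e' _ hne
    refine disjoint_left.mpr fun q hq hq' => hne ?_
    ext j
    rw [Fintype.mem_piFinset] at hq hq'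
    rw [← (mem_filter.mp (hq j)).2, ← (mem_filter.mp (hq' j)).2]

/-- `p` is a family of points of prescribed minimal periods lying on distinct cycles of `f`. -/
def IsCycleFamily {α I : Type*} (f : α → α) (ℓ : I → ℕ) (p : I → α) : Prop :=
  (∀ i, minimalPeriod f (p i) = ℓ i) ∧ Injective fun i => periodicOrbit f (p i)

open Finset in
-- Points of different minimal periods never share a cycle, so the choice factors over the lengths
-- `l`: an ordered choice of `r l` distinct cycles, then one of the `l` points on each.
theorem card_isCycleFamily {n L : ℕ} (f : Fin n → Fin n) (r : Finset.Icc 1 L → ℕ)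
    [DecidablePred fun p : (Σ l, Fin (r l)) → Fin n => IsCycleFamily f (fun i => (i.1 : ℕ)) p] :
    #{p : (Σ l, Fin (r l)) → Fin n | IsCycleFamily f (fun i => (i.1 : ℕ)) p} =
      (∏ l, (cycleVector f L l).descFactorial (r l)) * ∏ l : Finset.Icc 1 L, (l : ℕ) ^ r l := by
  classical
  have hsingle : ∀ l : Finset.Icc 1 L,
      #{q : Fin (r l) → Fin n | (∀ j, q j ∈ ({p | minimalPeriod f p = l} : Finset (Fin n))) ∧
        Injective (periodicOrbit f ∘ q)} =
      (cycleVector f L l).descFactorial (r l) * (l : ℕ) ^ r l := by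
    intro l
    have hl := (Finset.mem_Icc.mp l.2).1
    rw [card_tuples_injective_comp, cycleVector, cycleCount_eq_card_image f hl]
    intro b hb
    obtain ⟨p, hp, rfl⟩ := mem_image.mp hb
    rw [filter_filter]
    exact card_filter_periodicOrbit_eq hl (mem_filter.mp hp).2
  rw [← prod_mul_distrib, ← prod_congr rfl fun l _ => hsingle l, ← Fintype.card_piFinset]
  refine card_bij' (fun p _ l j => p ⟨l, j⟩) (fun q _ i => q i.1 i.2) ?_ ?_ ?_ ?_
  · intro p hp
    obtain ⟨h1, h2⟩ := (mem_filter.mp hp).2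
    simp only [Fintype.mem_piFinset, mem_filter, mem_univ, true_and]
    refine fun l => ⟨fun j => h1 ⟨l, j⟩, fun a b h => ?_⟩
    have := h2 h
    simpa using this
  · intro q hq
    simp only [Fintype.mem_piFinset, mem_filter, mem_univ, true_and] at hq
    refine mem_filter.mpr ⟨mem_univ _, fun i => (hq i.1).1 i.2, ?_⟩
    rintro ⟨l, j⟩ ⟨l', j'⟩ h
    have h' : periodicOrbit f (q l j) = periodicOrbit f (q l' j') := h
    have hl := congrArg Cycle.length h'
    rw [periodicOrbit_length, periodicOrbit_length, (hq l).1 j, (hq l').1 j'] at hl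
    obtain rfl : l = l' := Subtype.ext hl
    rw [(hq l).2 h']
  · intro p _; rfl
  · intro q _; rfl

/-! ### Cycles of iterates -/

theorem wordMap_pow {α : Type*} (f g : α → α) (u : Word) (d : ℕ) :
    wordMap f g (u ^ d) = (wordMap f g u)^[d] := by
  induction d with
  | zero => rfl
  | succ d ih =>
    rw [pow_succ, iterate_succ', ← ih]
    funext x
    simp [wordMap, FreeMonoid.toList_mul]

open Finset in
-- If `p` has period `m` under `f`, it has period `m / gcd(m, d)` under the iterate. Writing `m = g
-- * i` and `d = g * c` with `g = gcd(m, d)`, the numbers `i` and `c` are coprime and `m = d * i /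
-- c`.
theorem minimalPeriod_iterate_eq_iff {α : Type*} {f : α → α} {d : ℕ} (hd : 1 ≤ d) {i : ℕ}
    (p : α) :
    minimalPeriod f^[d] p = i ↔
      ∃ c ∈ d.divisors.filter (fun c => Nat.gcd i c = 1), minimalPeriod f p = d * i / c := by
  rw [minimalPeriod_iterate_eq_div_gcd (by omega)]
  set m := minimalPeriod f p
  simp only [mem_filter, Nat.mem_divisors]
  have hgpos : 0 < m.gcd d := Nat.gcd_pos_of_pos_right _ hd
  constructor
  · intro h
    obtain ⟨e, he⟩ := Nat.gcd_dvd_right m d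
    have hm : m = m.gcd d * i := by rw [← h, Nat.mul_div_cancel' (Nat.gcd_dvd_left m d)]
    have hepos : 0 < e := Nat.pos_of_ne_zero (by rintro rfl; omega)
    refine ⟨e, ⟨⟨⟨m.gcd d, by rw [mul_comm]; exact he⟩, by omega⟩, ?_⟩, ?_⟩
    · have h1 : Nat.gcd (m.gcd d * i) (m.gcd d * e) = m.gcd d := by rw [← hm, ← he]
      rw [Nat.gcd_mul_left] at h1
      exact Nat.eq_of_mul_eq_mul_left hgpos (by rw [h1, mul_one])
    · conv_rhs => rw [he]
      rw [mul_right_comm, Nat.mul_div_cancel _ hepos]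
      exact hm
  · rintro ⟨c, ⟨⟨⟨e, rfl⟩, -⟩, hc⟩, hm⟩
    have hcpos : 0 < c := Nat.pos_of_ne_zero (by rintro rfl; omega)
    have hepos : 0 < e := Nat.pos_of_ne_zero (by rintro rfl; omega)
    rw [mul_assoc, Nat.mul_div_cancel_left _ hcpos] at hm
    rw [hm, mul_comm c e, Nat.gcd_mul_left, hc, mul_one, Nat.mul_div_cancel_left _ hepos]

open Finset in
/-- The cycle counts of `f^[d]` in terms of those of `f`. -/
theorem cycleVector_iterate {n : ℕ} (f : Fin n → Fin n) {d : ℕ} (hd : 1 ≤ d) (L : ℕ) :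
    cycleVector f^[d] L = Psi d L (cycleVector f (d * L)) := by
  classical
  funext i
  have hi := (Finset.mem_Icc.mp i.2).1
  have hpos : ∀ c ∈ d.divisors.filter (fun c => Nat.gcd (i : ℕ) c = 1), 1 ≤ d * (i : ℕ) / c :=
    fun c hc => (Finset.mem_Icc.mp (index_mem i.2 hc)).1
  have hmulti : #{p : Fin n | minimalPeriod f^[d] p = i} =
      ∑ c ∈ d.divisors.filter (fun c => Nat.gcd (i : ℕ) c = 1),
        #{p : Fin n | minimalPeriod f p = d * (i : ℕ) / c} := by
    rw [← card_biUnion]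
    · congr 1
      ext p
      simp only [mem_filter, mem_univ, true_and, mem_biUnion, minimalPeriod_iterate_eq_iff hd]
    · intro c hc c' hc' hne
      refine disjoint_left.mpr fun p hp hp' => hne ?_
      have h1 := (mem_filter.mp hp).2
      have h2 := (mem_filter.mp hp').2
      have hdc := (Nat.mem_divisors.mp (mem_filter.mp hc).1).1.mul_right (i : ℕ)
      have hdc' := (Nat.mem_divisors.mp (mem_filter.mp hc').1).1.mul_right (i : ℕ)
      have e1 := Nat.mul_div_cancel' hdc
      have e2 := Nat.mul_div_cancel' hdc'
      rw [← h1] at e1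
      rw [← h2] at e2
      have := hpos c hc
      exact Nat.eq_of_mul_eq_mul_right (by omega) (e1.trans e2.symm)
  -- Points are counted instead of cycles: an `i`-cycle has `i` points, a cycle of length `d * i /
  -- c` has `(d / c) * i`, and cancelling `i` leaves the coefficient `d / c`.
  refine Nat.eq_of_mul_eq_mul_right hi ?_
  rw [show cycleVector f^[d] L i = cycleCount f^[d] i from rfl, cycleCount_mul_eq_card _ hi, hmulti,
    Psi, sum_mul, ← sum_attach]
  refine sum_congr rfl fun c _ => ?_
  rw [← cycleCount_mul_eq_card f (hpos c c.2)]
  obtain ⟨e, he⟩ := (Nat.mem_divisors.mp (mem_filter.mp c.2).1).1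
  have hcpos : 0 < (c : ℕ) := Nat.pos_of_ne_zero (by intro h; rw [h] at he; omega)
  have e1 : d / (c : ℕ) = e := by
    rw [Nat.div_eq_of_eq_mul_right hcpos he]
  have e2 : d * (i : ℕ) / (c : ℕ) = e * i := by
    refine Nat.div_eq_of_eq_mul_right hcpos ?_
    rw [← mul_assoc, ← he]
  simp only [cycleVector, e1, e2]
  ring

/-! ### Trajectories and configurations -/

/-- The trajectory of a point when the letters of a `k`-periodic sequence act successively. -/
def trajectory {α : Type*} {k : ℕ} (F : Letter × α → α) (lam : ZMod k → Letter) (p : α) : ℕ → α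
  | 0 => p
  | m + 1 => F (lam (m : ZMod k), trajectory F lam p m)

section Trajectory

variable {α : Type*} {k : ℕ} (F : Letter × α → α) (lam : ZMod k → Letter)

theorem trajectory_add (p : α) (m : ℕ) :
    trajectory F lam p (k + m) = trajectory F lam (trajectory F lam p k) m := by
  induction m with
  | zero => rfl
  | succ m ih =>
    rw [← add_assoc, trajectory, trajectory, ih]
    simp

/-- The letter sequence has period `k`, so each block of `k` steps applies the whole word once. -/
theorem trajectory_mul_add (p : α) (q m : ℕ) :
    trajectory F lam p (k * q + m) =
      trajectory F lam ((fun x => trajectory F lam x k)^[q] p) m := by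
  induction q generalizing p with
  | zero => simp
  | succ q ih =>
    rw [mul_add, mul_one, add_comm (k * q), add_assoc, trajectory_add, ih, iterate_succ_apply]

theorem trajectory_mul (p : α) (q : ℕ) :
    trajectory F lam p (k * q) = (fun x => trajectory F lam x k)^[q] p :=
  trajectory_mul_add F lam p q 0

theorem trajectory_length {u : Word} (hk : (FreeMonoid.toList u).length = k)
    (hlam : ∀ (m : ℕ) (hm : m < k), lam m = (FreeMonoid.toList u)[m]'(hk ▸ hm)) :
    (fun x => trajectory F lam x k) =
      wordMap (fun x => F (Letter.a, x)) (fun x => F (Letter.b, x)) u := by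
  funext p
  have hletter : ∀ l x, letterMap (fun x => F (Letter.a, x)) (fun x => F (Letter.b, x)) l x =
      F (l, x) := by
    rintro (_ | _) x <;> rfl
  have : ∀ m ≤ k, trajectory F lam p m =
      ((FreeMonoid.toList u).take m).foldl (fun y l => F (l, y)) p := by
    intro m
    induction m with
    | zero => intro _; rfl
    | succ m ih =>
      intro hm
      rw [trajectory, ih (by omega), hlam m hm, List.take_succ_eq_append_getElem (by omega),
        List.foldl_append]
      rfl
  rw [this k le_rfl, ← hk, List.take_length, wordMap]
  simp only [hletter]

open Finset in
/-- Families of points on distinct cycles of `h` correspond to cyclic configurations. -/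
theorem card_isCycleFamily_eq_card_configurations {I : Type*} [Fintype I] [DecidableEq I]
    [Fintype α] [DecidableEq α] [NeZero k] (ℓ : I → ℕ) [∀ i, NeZero (ℓ i)] (h : α → α)
    (hh : (fun x => trajectory F lam x k) = h)
    [DecidablePred fun p : I → α => IsCycleFamily h ℓ p]
    [DecidablePred fun y : (Σ i, ZMod (k * ℓ i)) → α => Set.InjOn y
      {t | ZMod.castHom (Dvd.intro (ℓ t.1) rfl) (ZMod k) t.2 = 0}] :
    #{p : I → α | IsCycleFamily h ℓ p} =
    #{y : (Σ i, ZMod (k * ℓ i)) → α | Set.InjOn y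
        {t | ZMod.castHom (Dvd.intro (ℓ t.1) rfl) (ZMod k) t.2 = 0} ∧
      ∀ t, F (lam (ZMod.castHom (Dvd.intro (ℓ t.1) rfl) (ZMod k) t.2), y t) =
        y ⟨t.1, t.2 + 1⟩} := by
  have hkpos : 0 < k := Nat.pos_of_neZero k
  have hℓpos : ∀ i, 0 < ℓ i := fun i => Nat.pos_of_neZero (ℓ i)
  have hmul : ∀ p q, trajectory F lam p (k * q) = h^[q] p := by
    intro p q; rw [trajectory_mul, hh]
  have hzero : ∀ (i : I) (s : ZMod (k * ℓ i)),
      ZMod.castHom (Dvd.intro (ℓ i) rfl) (ZMod k) s = 0 → ∃ m < ℓ i, s = (k * m : ℕ) := by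
    intro i s hs
    rw [← ZMod.natCast_zmod_val s, map_natCast, ZMod.natCast_eq_zero_iff] at hs
    obtain ⟨m, hm⟩ := hs
    refine ⟨m, ?_, by rw [← hm, ZMod.natCast_zmod_val]⟩
    have := ZMod.val_lt s
    rw [hm] at this
    exact Nat.lt_of_mul_lt_mul_left this
  have hconf : ∀ y : (Σ i, ZMod (k * ℓ i)) → α,
      (∀ t, F (lam (ZMod.castHom (Dvd.intro (ℓ t.1) rfl) (ZMod k) t.2), y t) =
        y ⟨t.1, t.2 + 1⟩) →
      ∀ i (m : ℕ), y ⟨i, (m : ZMod (k * ℓ i))⟩ = trajectory F lam (y ⟨i, 0⟩) m := by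
    intro y hy i m
    induction m with
    | zero => simp [trajectory]
    | succ m ih =>
      have := hy ⟨i, (m : ZMod (k * ℓ i))⟩
      rw [ih] at this
      simp only [map_natCast] at this
      rw [trajectory, this, Nat.cast_succ]
  -- The trajectory of `p i` closes up after `k * ℓ i` steps, so it is well defined on `ZMod (k * ℓ
  -- i)`.
  have hfam : ∀ p : I → α, IsCycleFamily h ℓ p → ∀ i (m : ℕ),
      trajectory F lam (p i) ((m : ZMod (k * ℓ i)).val) = trajectory F lam (p i) m := by
    intro p hp i m
    rw [ZMod.val_natCast]
    conv_rhs => rw [← Nat.div_add_mod m (k * ℓ i), mul_assoc, trajectory_mul_add, hh, iterate_mul,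
      iterate_fixed (by rw [← hp.1 i, iterate_minimalPeriod])]
  have hdvd0 : ∀ i (m : ℕ),
      (⟨i, ((k * m : ℕ) : ZMod (k * ℓ i))⟩ : Σ i, ZMod (k * ℓ i)) ∈
        {t : Σ i, ZMod (k * ℓ i) | ZMod.castHom (Dvd.intro (ℓ t.1) rfl) (ZMod k) t.2 = 0} := by
    intro i m
    change ZMod.castHom _ (ZMod k) ((k * m : ℕ) : ZMod (k * ℓ i)) = 0
    rw [map_natCast, ZMod.natCast_eq_zero_iff]
    exact Dvd.intro _ rfl
  have hdvd0' : ∀ i, (⟨i, 0⟩ : Σ i, ZMod (k * ℓ i)) ∈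
        {t : Σ i, ZMod (k * ℓ i) | ZMod.castHom (Dvd.intro (ℓ t.1) rfl) (ZMod k) t.2 = 0} :=
    fun i => map_zero (ZMod.castHom (Dvd.intro (ℓ i) rfl) (ZMod k))
  refine card_bij' (fun p _ t => trajectory F lam (p t.1) t.2.val) (fun y _ i => y ⟨i, 0⟩)
    ?_ ?_ ?_ ?_
  · intro p hp
    have hp := (mem_filter.mp hp).2
    have hper : ∀ i, p i ∈ periodicPts h := fun i =>
      minimalPeriod_pos_iff_mem_periodicPts.mp (by rw [hp.1]; exact hℓpos i)
    refine mem_filter.mpr ⟨mem_univ _, ?_, ?_⟩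
    -- At multiples of `k` the trajectory runs along a cycle of `h`: distinctness of the cycles
    -- gives `i = j`, and minimality of the period gives `m = m'`.
    · rintro ⟨i, s⟩ hs ⟨j, t⟩ ht heq
      obtain ⟨m, hm, rfl⟩ := hzero i s hs
      obtain ⟨m', hm', rfl⟩ := hzero j t ht
      simp only [hfam p hp, hmul] at heq
      have hij : i = j := by
        refine hp.2 ?_
        change periodicOrbit h (p i) = periodicOrbit h (p j)
        rw [← periodicOrbit_apply_iterate_eq (hper i) m, heq,
          periodicOrbit_apply_iterate_eq (hper j)]
      subst hij
      rw [← hp.1 i] at hm hm'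
      rw [iterate_injOn_Iio_minimalPeriod hm hm' heq]
    · rintro ⟨i, s⟩
      rw [← ZMod.natCast_zmod_val s, ← Nat.cast_succ]
      simp only [hfam p hp, map_natCast]
      rfl
  · intro y hy
    obtain ⟨hy1, hy2⟩ := (mem_filter.mp hy).2
    have hyt := hconf y hy2
    have hyit : ∀ i m, h^[m] (y ⟨i, 0⟩) = y ⟨i, ((k * m : ℕ) : ZMod (k * ℓ i))⟩ := by
      intro i m; rw [hyt, hmul]
    -- An earlier return to `y ⟨i, 0⟩` would repeat a value on the beginnings of the word, against
    -- injectivity there. The same injectivity later separates the cycles.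
    have hmin : ∀ i, minimalPeriod h (y ⟨i, 0⟩) = ℓ i := by
      intro i
      have hper : IsPeriodicPt h (ℓ i) (y ⟨i, 0⟩) := by
        rw [IsPeriodicPt, IsFixedPt, hyit, ZMod.natCast_self]
      refine Nat.dvd_antisymm hper.minimalPeriod_dvd ?_
      have h1 := hyit i (minimalPeriod h (y ⟨i, 0⟩))
      rw [iterate_minimalPeriod] at h1
      have h2 := hy1 (hdvd0' i) (hdvd0 i _) h1
      have h3 : (0 : ZMod (k * ℓ i)) = ((k * minimalPeriod h (y ⟨i, 0⟩) : ℕ) : ZMod (k * ℓ i)) := by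
        simpa using h2
      have h4 := (ZMod.natCast_eq_zero_iff _ _).mp h3.symm
      exact Nat.dvd_of_mul_dvd_mul_left hkpos h4
    refine mem_filter.mpr ⟨mem_univ _, hmin, fun i j hij => ?_⟩
    have hper : ∀ i, y ⟨i, 0⟩ ∈ periodicPts h := fun i =>
      minimalPeriod_pos_iff_mem_periodicPts.mp (by rw [hmin]; exact hℓpos i)
    obtain ⟨m, hm⟩ := (periodicOrbit_eq_iff (hper i) (hper j)).mp hij
    rw [hyit] at hm
    exact congrArg Sigma.fst (hy1 (hdvd0 i m) (hdvd0' j) hm)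
  · intro p _
    funext i
    simp [trajectory]
  · intro y hy
    funext ⟨i, s⟩
    have := hconf y (mem_filter.mp hy).2.2 i s.val
    rw [ZMod.natCast_zmod_val] at this
    exact this.symm

end Trajectory

/-! ### Limits of the factorial moments -/

instance : DecidableEq Letter := fun x y => by
  cases x <;> cases y <;> first | exact isTrue rfl | exact isFalse nofun

instance : Fintype Letter := ⟨{Letter.a, Letter.b}, by rintro (_ | _) <;> simp⟩

theorem card_letter : Fintype.card Letter = 2 := rfl

open Finset in
/-- The mean factorial moments of the cycle counts of a primitive word map converge. -/
theorem tendsto_mean_prod_descFactorial {u : Word} (hu : IsPrimitive u) (L : ℕ)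
    (r : Finset.Icc 1 L → ℕ) :
    Tendsto (fun n : ℕ => (∑ F : Letter × Fin n → Fin n, ∏ l,
      ((cycleVector (wordMap (fun x => F (Letter.a, x)) (fun x => F (Letter.b, x)) u) L
        l).descFactorial (r l) : ℝ)) / (n : ℝ) ^ (2 * n)) atTop
      (𝓝 (∏ l : Finset.Icc 1 L, (1 / (l : ℝ)) ^ r l)) := by
  classical
  set k := (FreeMonoid.toList u).length with hk
  have hkpos : 0 < k := List.length_pos_of_ne_nil hu.toList_ne_nil
  have : NeZero k := ⟨hkpos.ne'⟩
  set lam : ZMod k → Letter := fun s => (FreeMonoid.toList u)[s.val]'(ZMod.val_lt s) with hlamdef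
  have hlam : ∀ (m : ℕ) (hm : m < k), lam m = (FreeMonoid.toList u)[m] := by
    intro m hm
    simp only [hlamdef, ZMod.val_natCast, Nat.mod_eq_of_lt hm]
  let I := Σ l : Finset.Icc 1 L, Fin (r l)
  let ℓ : I → ℕ := fun i => (i.1 : ℕ)
  have : ∀ i, NeZero (ℓ i) := fun i =>
    ⟨by have := (Finset.mem_Icc.mp i.1.2).1; change (i.1 : ℕ) ≠ 0; omega⟩
  let pr : (Σ i, ZMod (k * ℓ i)) → ZMod k :=
    fun t => ZMod.castHom (Dvd.intro (ℓ t.1) rfl) (ZMod k) t.2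
  let tau : (Σ i, ZMod (k * ℓ i)) → (Σ i, ZMod (k * ℓ i)) := fun t => ⟨t.1, t.2 + 1⟩
  have htau : Injective tau := by
    rintro ⟨i, s⟩ ⟨j, t⟩ h
    obtain rfl : i = j := congrArg Sigma.fst h
    have : s + 1 = t + 1 := by simpa [tau] using h
    rw [add_right_cancel this]
  have hit : ∀ m t, tau^[m] t = ⟨t.1, t.2 + m⟩ := by
    intro m t
    induction m with
    | zero => simp
    | succ m ih =>
      rw [iterate_succ_apply', ih]
      simp [tau, add_assoc]
  have hpr : ∀ m t, pr (tau^[m] t) = pr t + m := by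
    intro m t
    rw [hit]
    simp only [pr, map_add, map_natCast]
  have hsep : ∀ t t', (∀ m, lam (pr (tau^[m] t)) = lam (pr (tau^[m] t'))) → t ≠ t' →
      ∃ m, tau^[m] t ∈ {t | pr t = 0} ∧ tau^[m] t' ∈ {t | pr t = 0} := by
    intro t t' h _
    have heq : pr t = pr t' := hu.cyclic_letters_injective lam rfl hlam
      (fun m => by rw [← hpr, ← hpr]; exact h m)
    -- Both positions have the same residue modulo `k`, so this number of steps brings both to
    -- residue `0`.
    refine ⟨(-(pr t)).val, ?_, ?_⟩
    · change pr _ = 0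
      rw [hpr, ZMod.natCast_zmod_val, add_neg_cancel]
    · change pr _ = 0
      rw [hpr, ZMod.natCast_zmod_val, heq, add_neg_cancel]
  have hmain := tendsto_sum_card_configurations htau (lam := fun t => lam (pr t)) hsep
  have hP : (∏ l : Finset.Icc 1 L, ((l : ℕ) : ℝ) ^ r l) ≠ 0 := by
    refine prod_ne_zero_iff.mpr fun l _ => pow_ne_zero _ ?_
    have := (Finset.mem_Icc.mp l.2).1
    exact Nat.cast_ne_zero.mpr (by omega)
  have hmain' := hmain.div_const (∏ l : Finset.Icc 1 L, ((l : ℕ) : ℝ) ^ r l)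
  have hlim : 1 / (∏ l : Finset.Icc 1 L, ((l : ℕ) : ℝ) ^ r l) =
      ∏ l : Finset.Icc 1 L, (1 / (l : ℝ)) ^ r l := by
    simp only [one_div, inv_pow, prod_inv_distrib]
  rw [hlim] at hmain'
  refine hmain'.congr fun n => ?_
  rw [card_letter, div_right_comm]
  congr 1
  rw [div_eq_iff hP, sum_mul]
  refine sum_congr rfl fun F _ => ?_
  have h1 := card_isCycleFamily_eq_card_configurations F lam ℓ _
    (trajectory_length F lam rfl hlam)
  have h2 := card_isCycleFamily
    (wordMap (fun x => F (Letter.a, x)) (fun x => F (Letter.b, x)) u) r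
  have h3 := h1.symm.trans h2
  exact_mod_cast h3

/-! ### From factorial moments to polynomial expectations -/

open Finset in
-- Multiplying the falling factorial of order `k` by `x` gives the one of order `k + 1` plus `k`
-- times itself, which matches the Stirling recurrence.
theorem pow_eq_sum_stirlingSecond_mul_descFactorial (x r : ℕ) :
    x ^ r = ∑ k ∈ range (r + 1), Nat.stirlingSecond r k * x.descFactorial k := by
  induction r with
  | zero => simp
  | succ r ih =>
    have hx : ∀ k, x.descFactorial k * x = x.descFactorial (k + 1) + k * x.descFactorial k := by
      intro k
      rw [Nat.descFactorial_succ]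
      rcases le_or_gt k x with h | h
      · rw [← add_mul, Nat.sub_add_cancel h, mul_comm]
      · rw [Nat.descFactorial_of_lt h]; simp
    -- The index shift is free: the term at `0` has factor `0`, and the added term at `r + 1` has a
    -- vanishing Stirling number.
    have hshift : ∑ k ∈ range (r + 1), Nat.stirlingSecond r k * (k * x.descFactorial k) =
        ∑ k ∈ range (r + 1),
          (k + 1) * Nat.stirlingSecond r (k + 1) * x.descFactorial (k + 1) := by
      have h1 := sum_range_succ (fun k => Nat.stirlingSecond r k * (k * x.descFactorial k)) (r + 1)
      have h2 := sum_range_succ' (fun k => Nat.stirlingSecond r k * (k * x.descFactorial k)) (r + 1)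
      rw [Nat.stirlingSecond_eq_zero_of_lt (Nat.lt_succ_self r), zero_mul, add_zero] at h1
      rw [zero_mul, mul_zero, add_zero] at h2
      rw [← h1, h2]
      exact sum_congr rfl fun k _ => by ring
    rw [pow_succ, ih, sum_mul, sum_range_succ' _ (r + 1), Nat.stirlingSecond_succ_zero, zero_mul,
      add_zero]
    simp only [Nat.stirlingSecond_succ_succ, add_mul, sum_add_distrib]
    simp only [mul_assoc] at hshift
    simp only [mul_assoc, hx, mul_add, sum_add_distrib, hshift]
    simp only [add_mul, sum_add_distrib, one_mul]
    ring

/-- The expectations of `φ (X n)` are finite and converge to the finite expectation of `φ Y`. -/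
def TendstoExpectation {ι : Type*} {Ω : ℕ → Type*} [∀ n, MeasurableSpace (Ω n)]
    (X : (n : ℕ) → Ω n → ι → ℕ) (μ : (n : ℕ) → Measure (Ω n))
    {Ω' : Type*} [MeasurableSpace Ω'] (Y : Ω' → ι → ℕ) (μ' : Measure Ω')
    (φ : (ι → ℕ) → ℝ) : Prop :=
  (∀ n, Integrable (fun ω => φ (X n ω)) (μ n)) ∧ Integrable (fun ω => φ (Y ω)) μ' ∧
    Tendsto (fun n => ∫ ω, φ (X n ω) ∂(μ n)) atTop (𝓝 (∫ ω, φ (Y ω) ∂μ'))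

section Expectation

variable {ι : Type*} {Ω : ℕ → Type*} [∀ n, MeasurableSpace (Ω n)]
    {X : (n : ℕ) → Ω n → ι → ℕ} {μ : (n : ℕ) → Measure (Ω n)}
    {Ω' : Type*} [MeasurableSpace Ω'] {Y : Ω' → ι → ℕ} {μ' : Measure Ω'}

theorem TendstoExpectation.const_mul {φ : (ι → ℕ) → ℝ} (h : TendstoExpectation X μ Y μ' φ)
    (c : ℝ) : TendstoExpectation X μ Y μ' (fun x => c * φ x) := by
  refine ⟨fun n => (h.1 n).const_mul c, h.2.1.const_mul c, ?_⟩
  simp only [integral_const_mul]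
  exact h.2.2.const_mul c

theorem TendstoExpectation.sum {κ : Type*} (s : Finset κ) {φ : κ → (ι → ℕ) → ℝ}
    (h : ∀ k ∈ s, TendstoExpectation X μ Y μ' (φ k)) :
    TendstoExpectation X μ Y μ' (fun x => ∑ k ∈ s, φ k x) := by
  refine ⟨fun n => integrable_finsetSum _ fun k hk => (h k hk).1 n,
    integrable_finsetSum _ fun k hk => (h k hk).2.1, ?_⟩
  rw [integral_finsetSum _ fun k hk => (h k hk).2.1]
  simp only [fun n => integral_finsetSum s fun k hk => (h k hk).1 n]
  exact tendsto_finsetSum _ fun k hk => (h k hk).2.2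

variable [Fintype ι]

/-- Convergence of factorial moments implies convergence of moments. -/
theorem tendstoInMoments_of_descFactorial
    (h : ∀ r : ι → ℕ, TendstoExpectation X μ Y μ' fun x => ∏ i, ((x i).descFactorial (r i) : ℝ)) :
    TendstoInMoments X μ Y μ' := by
  classical
  intro r
  have hexp : ∀ x : ι → ℕ, ∏ i, (x i : ℝ) ^ r i =
      ∑ s ∈ Fintype.piFinset fun i => Finset.range (r i + 1),
        (∏ i, (Nat.stirlingSecond (r i) (s i) : ℝ)) * ∏ i, ((x i).descFactorial (s i) : ℝ) := by
    intro x
    simp only [← Finset.prod_mul_distrib]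
    rw [← Finset.prod_univ_sum (fun i => Finset.range (r i + 1)) fun i k =>
      (Nat.stirlingSecond (r i) k : ℝ) * ((x i).descFactorial k : ℝ)]
    refine Finset.prod_congr rfl fun i _ => ?_
    exact_mod_cast pow_eq_sum_stirlingSecond_mul_descFactorial (x i) (r i)
  have := TendstoExpectation.sum (Fintype.piFinset fun i => Finset.range (r i + 1))
    fun s _ => (h s).const_mul (∏ i, (Nat.stirlingSecond (r i) (s i) : ℝ))
  simp only [← hexp] at this
  exact this

theorem TendstoInMoments.tendstoExpectation (h : TendstoInMoments X μ Y μ')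
    (p : MvPolynomial ι ℝ) :
    TendstoExpectation X μ Y μ' fun x => MvPolynomial.eval (fun i => (x i : ℝ)) p := by
  simp only [MvPolynomial.eval_eq']
  refine TendstoExpectation.sum _ fun d _ => TendstoExpectation.const_mul
    (φ := fun x => ∏ i, (x i : ℝ) ^ d i) (h d) _

/-- Each monomial in the coordinates of `Psi` is a polynomial in the original coordinates. -/
theorem TendstoInMoments.psi {d L : ℕ} {X : (n : ℕ) → Ω n → Finset.Icc 1 (d * L) → ℕ}
    {Y : Ω' → Finset.Icc 1 (d * L) → ℕ} (h : TendstoInMoments X μ Y μ') :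
    TendstoInMoments (fun n ω => Psi d L (X n ω)) μ (fun ω => Psi d L (Y ω)) μ' := by
  intro r
  have := h.tendstoExpectation (∏ i : Finset.Icc 1 L,
    (∑ c ∈ (d.divisors.filter (fun c => Nat.gcd (i : ℕ) c = 1)).attach,
      MvPolynomial.C ((d / (c : ℕ) : ℕ) : ℝ) *
        MvPolynomial.X ⟨d * (i : ℕ) / (c : ℕ), index_mem i.2 c.2⟩) ^ r i)
  simp only [map_prod, map_pow, map_sum, map_mul, MvPolynomial.eval_C, MvPolynomial.eval_X] at this
  simp only [Psi, Nat.cast_sum, Nat.cast_mul]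
  exact this

end Expectation

/-! ### Method of moments -/

/-- The derivative of the remainder of order `N + 1` is `I` times that of order `N`; the inductive
bound is integrated along the segment from `0` to `x`, parametrised by `s ∈ [0, 1]`. -/
theorem norm_exp_mul_I_sub_sum_le (N : ℕ) (x : ℝ) :
    ‖Complex.exp (x * Complex.I) -
      ∑ m ∈ Finset.range N, (x * Complex.I) ^ m / (m.factorial : ℂ)‖ ≤
      |x| ^ N / (N.factorial : ℝ) := by
  induction N generalizing x with
  | zero => simp [Complex.norm_exp_ofReal_mul_I]
  | succ N ih =>
    let R : ℕ → ℝ → ℂ := fun N y => Complex.exp (y * Complex.I) -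
      ∑ m ∈ Finset.range N, (y * Complex.I) ^ m / (m.factorial : ℂ)
    have hd : ∀ y : ℝ, HasDerivAt (R (N + 1)) (Complex.I * R N y) y := by
      intro y
      have hI : HasDerivAt (fun y : ℝ => (y : ℂ) * Complex.I) Complex.I y := by
        simpa using (Complex.ofRealCLM.hasDerivAt (x := y)).mul_const Complex.I
      have h1 : HasDerivAt (fun y : ℝ => Complex.exp (y * Complex.I))
          (Complex.exp (y * Complex.I) * Complex.I) y := hI.cexp
      have h2 : ∀ m ∈ Finset.range (N + 1), HasDerivAt
          (fun y : ℝ => ((y : ℂ) * Complex.I) ^ m / (m.factorial : ℂ))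
          (m * ((y : ℂ) * Complex.I) ^ (m - 1) * Complex.I / (m.factorial : ℂ)) y :=
        fun m _ => (hI.pow m).div_const _
      have h3 := h1.sub (HasDerivAt.fun_sum h2)
      refine h3.congr_deriv ?_
      rw [Finset.sum_range_succ', mul_sub, Finset.mul_sum]
      simp only [Nat.cast_zero, zero_mul, zero_div, add_zero]
      congr 1
      · ring
      · refine Finset.sum_congr rfl fun m _ => ?_
        have hm : ((m + 1 : ℕ) : ℂ) ≠ 0 := Nat.cast_ne_zero.mpr (by omega)
        rw [Nat.factorial_succ, Nat.cast_mul, Nat.add_sub_cancel, mul_assoc,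
          mul_div_mul_left _ _ hm]
        ring
    have hd' : ∀ s : ℝ, HasDerivAt (fun s : ℝ => R (N + 1) (s * x))
        ((x : ℂ) * (Complex.I * R N (s * x))) s := by
      intro s
      have := (hd (s * x)).scomp s (hasDerivAt_mul_const x)
      rwa [Complex.real_smul] at this
    have hB : ∀ s : ℝ, HasDerivAt
        (fun s : ℝ => |x| ^ (N + 1) * s ^ (N + 1) / ((N + 1).factorial : ℝ))
        (|x| ^ (N + 1) * s ^ N / (N.factorial : ℝ)) s := by
      intro s
      have := ((hasDerivAt_pow (N + 1) s).const_mul (|x| ^ (N + 1))).div_const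
        ((N + 1).factorial : ℝ)
      refine this.congr_deriv ?_
      rw [Nat.factorial_succ, Nat.cast_mul, Nat.add_sub_cancel, mul_left_comm,
        mul_div_mul_left _ _ (Nat.cast_ne_zero.mpr (by omega))]
    have hR0 : R (N + 1) 0 = 0 := by
      simp only [R, Finset.sum_range_succ']
      simp
    have := image_norm_le_of_norm_deriv_right_le_deriv_boundary (a := 0) (b := 1)
      (f := fun s : ℝ => R (N + 1) (s * x))
      (fun s _ => (hd' s).continuousAt.continuousWithinAt)
      (fun s _ => (hd' s).hasDerivWithinAt) (by simp [hR0]) hB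
      (fun s hs => by
        rw [norm_mul, norm_mul, Complex.norm_I, one_mul, Complex.norm_real, Real.norm_eq_abs]
        refine (mul_le_mul_of_nonneg_left (ih (s * x)) (abs_nonneg x)).trans (le_of_eq ?_)
        rw [abs_mul, abs_of_nonneg hs.1]
        ring) (Set.right_mem_Icc.mpr zero_le_one)
    simpa [R] using this

section Moments

variable {ι : Type*} [Fintype ι]

/-- The embedding of integer vectors in Euclidean space. -/
noncomputable def euclideanEmbedding (ι : Type*) [Fintype ι] (x : ι → ℕ) : EuclideanSpace ℝ ι :=
  WithLp.toLp 2 fun i => (x i : ℝ)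

theorem isClosedEmbedding_euclideanEmbedding :
    IsClosedEmbedding (euclideanEmbedding ι) :=
  (PiLp.homeomorph 2 (fun _ : ι => ℝ)).symm.isClosedEmbedding.comp
    (IsClosedEmbedding.piMap fun _ : ι => Nat.isClosedEmbedding_coe_real)

theorem measurable_euclideanEmbedding : Measurable (euclideanEmbedding ι) := .of_discrete

theorem charFun_map_euclideanEmbedding {Ω : Type*} [MeasurableSpace Ω] {μ : Measure Ω}
    {X : Ω → ι → ℕ} (hX : AEMeasurable X μ) (t : EuclideanSpace ℝ ι) :
    charFun ((μ.map X).map (euclideanEmbedding ι)) t =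
      ∫ ω, Complex.exp ((∑ i, t i * X ω i : ℝ) * Complex.I) ∂μ := by
  rw [charFun_apply, integral_map measurable_euclideanEmbedding.aemeasurable
    (by fun_prop), integral_map hX .of_discrete]
  refine integral_congr_ae (Eventually.of_forall fun ω => ?_)
  simp [euclideanEmbedding, PiLp.inner_apply]

/-- If `exp |S|` is integrable, then the Taylor remainders of `exp (i S)` tend to `0` in mean. -/
theorem tendsto_integral_abs_pow_div_factorial {Ω : Type*} [MeasurableSpace Ω] {μ : Measure Ω}
    {S : Ω → ℝ} (hS : AEStronglyMeasurable S μ) (hexp : Integrable (fun ω => Real.exp |S ω|) μ) :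
    Tendsto (fun N : ℕ => ∫ ω, |S ω| ^ N / (N.factorial : ℝ) ∂μ) atTop (𝓝 0) := by
  have := tendsto_integral_of_dominated_convergence (μ := μ)
    (F := fun N ω => |S ω| ^ N / (N.factorial : ℝ)) (f := fun _ => 0)
    (fun ω => Real.exp |S ω|) (fun N => by fun_prop) hexp
    (fun N => Eventually.of_forall fun ω => by
      rw [Real.norm_of_nonneg (by positivity)]
      exact Real.pow_div_factorial_le_exp _ (abs_nonneg _) N)
    (Eventually.of_forall fun ω => FloorSemiring.tendsto_pow_div_factorial_atTop _)
  simpa using this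

theorem norm_integral_exp_sub_sum_le {Ω : Type*} [MeasurableSpace Ω] {μ : Measure Ω}
    [IsProbabilityMeasure μ] {S : Ω → ℝ} (hS : AEStronglyMeasurable S μ)
    (hint : ∀ m : ℕ, Integrable (fun ω => S ω ^ m) μ) (N : ℕ) :
    ‖∫ ω, Complex.exp (S ω * Complex.I) ∂μ -
      ∑ m ∈ Finset.range N, Complex.I ^ m / (m.factorial : ℂ) * ((∫ ω, S ω ^ m ∂μ : ℝ) : ℂ)‖ ≤
      ∫ ω, |S ω| ^ N / (N.factorial : ℝ) ∂μ := by
  have hintC : ∀ m : ℕ, Integrable (fun ω => ((S ω * Complex.I) ^ m / (m.factorial : ℂ))) μ := by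
    intro m
    have : (fun ω => ((S ω * Complex.I) ^ m / (m.factorial : ℂ))) =
        fun ω => Complex.I ^ m / (m.factorial : ℂ) * ((S ω ^ m : ℝ) : ℂ) := by
      funext ω; push_cast; ring
    rw [this]
    exact (hint m).ofReal.const_mul _
  have hE : Integrable (fun ω => Complex.exp (S ω * Complex.I)) μ := by
    refine Integrable.of_bound (by fun_prop) 1 (Eventually.of_forall fun ω => ?_)
    rw [Complex.norm_exp_ofReal_mul_I]
  have hsum : ∑ m ∈ Finset.range N, Complex.I ^ m / (m.factorial : ℂ) *
      ((∫ ω, S ω ^ m ∂μ : ℝ) : ℂ) =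
      ∫ ω, ∑ m ∈ Finset.range N, (S ω * Complex.I) ^ m / (m.factorial : ℂ) ∂μ := by
    rw [integral_finsetSum _ fun m _ => hintC m]
    refine Finset.sum_congr rfl fun m _ => ?_
    rw [← integral_complex_ofReal, ← integral_const_mul]
    congr 1
    funext ω; push_cast; ring
  rw [hsum, ← integral_sub hE (integrable_finsetSum _ fun m _ => hintC m)]
  refine (norm_integral_le_integral_norm _).trans ?_
  refine integral_mono (hE.sub (integrable_finsetSum _ fun m _ => hintC m)).norm ?_
    fun ω => norm_exp_mul_I_sub_sum_le N (S ω)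
  have := (hint N).abs
  simp only [abs_pow] at this
  exact this.div_const _

variable {Ω : ℕ → Type*} [∀ n, MeasurableSpace (Ω n)]
    {X : (n : ℕ) → Ω n → ι → ℕ} {μ : (n : ℕ) → Measure (Ω n)} [∀ n, IsProbabilityMeasure (μ n)]
    {Ω' : Type*} [MeasurableSpace Ω'] {Y : Ω' → ι → ℕ} {μ' : Measure Ω'} [IsProbabilityMeasure μ']

/-- The exponential is replaced by a Taylor polynomial, whose expectation converges. Both truncation
errors are bounded by a single moment, so exponential integrability is needed only for the limit. -/
theorem TendstoInMoments.tendsto_integral_exp (h : TendstoInMoments X μ Y μ')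
    (hX : ∀ n, AEMeasurable (X n) (μ n)) (hY : AEMeasurable Y μ')
    (hexp : ∀ c : ℝ, Integrable (fun ω => Real.exp (c * ∑ i, (Y ω i : ℝ))) μ') (t : ι → ℝ) :
    Tendsto (fun n => ∫ ω, Complex.exp ((∑ i, t i * X n ω i : ℝ) * Complex.I) ∂(μ n)) atTop
      (𝓝 (∫ ω, Complex.exp ((∑ i, t i * Y ω i : ℝ) * Complex.I) ∂μ')) := by
  set s : (ι → ℕ) → ℝ := fun x => ∑ i, t i * x i with hs
  have hpow : ∀ m : ℕ, TendstoExpectation X μ Y μ' fun x => s x ^ m := by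
    intro m
    have := h.tendstoExpectation ((∑ i, MvPolynomial.C (t i) * MvPolynomial.X i) ^ m)
    simpa only [map_pow, map_sum, map_mul, MvPolynomial.eval_C, MvPolynomial.eval_X] using this
  have hsX : ∀ n, AEStronglyMeasurable (fun ω => s (X n ω)) (μ n) := fun n =>
    ((Measurable.of_discrete (f := s)).comp_aemeasurable (hX n)).aestronglyMeasurable
  have hsY : AEStronglyMeasurable (fun ω => s (Y ω)) μ' :=
    ((Measurable.of_discrete (f := s)).comp_aemeasurable hY).aestronglyMeasurable
  have hexpS : Integrable (fun ω => Real.exp |s (Y ω)|) μ' := by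
    refine (hexp (∑ i, |t i|)).mono' (by fun_prop) (Eventually.of_forall fun ω => ?_)
    rw [Real.norm_of_nonneg (Real.exp_pos _).le, Real.exp_le_exp, Finset.sum_mul]
    refine (Finset.abs_sum_le_sum_abs _ _).trans (Finset.sum_le_sum fun i _ => ?_)
    rw [abs_mul, Nat.abs_cast]
    exact mul_le_mul_of_nonneg_left
      (Finset.single_le_sum (f := fun i => (Y ω i : ℝ)) (fun _ _ => Nat.cast_nonneg _)
        (Finset.mem_univ i)) (abs_nonneg _)
  have htail := tendsto_integral_abs_pow_div_factorial hsY hexpS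
  rw [Metric.tendsto_atTop]
  intro ε hε
  obtain ⟨M, hM⟩ := (htail.eventually
    (gt_mem_nhds (show (0 : ℝ) < ε / 3 by positivity))).exists_forall_of_atTop
  -- The order is taken even so that `|s| ^ (2 * M)` is a polynomial in the coordinates. Its
  -- expectation converges, and smallness of the remainder passes from the limit to all large `n`.
  have hMM := hM (2 * M) (by omega)
  have heven : ∀ x : ℝ, |x| ^ (2 * M) = x ^ (2 * M) := fun x => (even_two_mul M).pow_abs x
  have htailX : Tendsto (fun n => ∫ ω, |s (X n ω)| ^ (2 * M) / ((2 * M).factorial : ℝ) ∂(μ n)) atTop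
      (𝓝 (∫ ω, |s (Y ω)| ^ (2 * M) / ((2 * M).factorial : ℝ) ∂μ')) := by
    simp only [heven, integral_div]
    exact (hpow (2 * M)).2.2.div_const _
  have hQ : Tendsto (fun n => ∑ m ∈ Finset.range (2 * M), Complex.I ^ m / (m.factorial : ℂ) *
      ((∫ ω, s (X n ω) ^ m ∂(μ n) : ℝ) : ℂ)) atTop
      (𝓝 (∑ m ∈ Finset.range (2 * M), Complex.I ^ m / (m.factorial : ℂ) *
      ((∫ ω, s (Y ω) ^ m ∂μ' : ℝ) : ℂ))) :=
    tendsto_finsetSum _ fun m _ =>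
      ((Complex.continuous_ofReal.tendsto _).comp (hpow m).2.2).const_mul _
  obtain ⟨n₁, hn₁⟩ := (htailX.eventually (gt_mem_nhds hMM)).exists_forall_of_atTop
  obtain ⟨n₂, hn₂⟩ := Metric.tendsto_atTop.mp hQ (ε / 3) (by positivity)
  refine ⟨max n₁ n₂, fun n hn => ?_⟩
  have e1 := (norm_integral_exp_sub_sum_le (hsX n) (fun m => (hpow m).1 n) (2 * M)).trans_lt
    (hn₁ n (le_of_max_le_left hn))
  have e2 := hn₂ n (le_of_max_le_right hn)
  have e3 := (norm_integral_exp_sub_sum_le hsY (fun m => (hpow m).2.1) (2 * M)).trans_lt hMM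
  rw [← dist_eq_norm] at e1 e3
  rw [dist_comm] at e3
  calc _ ≤ _ := dist_triangle4 _ _ _ _
    _ < ε / 3 + ε / 3 + ε / 3 := by gcongr
    _ = ε := by ring

/-- Method of moments: convergence of all joint moments to those of a vector with finite
exponential moments implies convergence in distribution. -/
theorem TendstoInMoments.tendstoInDistribution (h : TendstoInMoments X μ Y μ')
    (hX : ∀ n, AEMeasurable (X n) (μ n)) (hY : AEMeasurable Y μ')
    (hexp : ∀ c : ℝ, Integrable (fun ω => Real.exp (c * ∑ i, (Y ω i : ℝ))) μ') :
    TendstoInDistribution X atTop Y μ μ' where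
  forall_aemeasurable := hX
  aemeasurable_limit := hY
  tendsto := by
    have hPX : ∀ n, IsProbabilityMeasure ((μ n).map (X n)) := fun n =>
      Measure.isProbabilityMeasure_map (hX n)
    have hPY : IsProbabilityMeasure (μ'.map Y) := Measure.isProbabilityMeasure_map hY
    have hme := (measurable_euclideanEmbedding (ι := ι)).aemeasurable (μ := μ'.map Y)
    have hmeX := fun n => (measurable_euclideanEmbedding (ι := ι)).aemeasurable
      (μ := (μ n).map (X n))
    -- Lévy's continuity theorem is applied to the images in Euclidean space.
    have hconv : Tendsto (β := ProbabilityMeasure (EuclideanSpace ℝ ι))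
        (fun n => ⟨((μ n).map (X n)).map (euclideanEmbedding ι),
          Measure.isProbabilityMeasure_map (hmeX n)⟩) atTop
        (𝓝 ⟨(μ'.map Y).map (euclideanEmbedding ι), Measure.isProbabilityMeasure_map hme⟩) := by
      refine ProbabilityMeasure.tendsto_of_tendsto_charFun fun t => ?_
      simp only [ProbabilityMeasure.coe_mk, charFun_map_euclideanEmbedding (hX _),
        charFun_map_euclideanEmbedding hY]
      exact h.tendsto_integral_exp hX hY hexp t
    refine ProbabilityMeasure.tendsto_iff_forall_integral_tendsto.mpr fun f => ?_
    -- By Tietze, a bounded continuous test function on integer vectors extends along the closed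
    -- embedding, so weak convergence comes back from Euclidean space.
    obtain ⟨g, -, hg⟩ :=
      BoundedContinuousFunction.exists_extension_norm_eq_of_isClosedEmbedding f
        (isClosedEmbedding_euclideanEmbedding (ι := ι))
    have hgf : ∀ x, g (euclideanEmbedding ι x) = f x := congrFun hg
    have := ProbabilityMeasure.tendsto_iff_forall_integral_tendsto.mp hconv g
    simp only [ProbabilityMeasure.coe_mk] at this ⊢
    rw [integral_map hme (by fun_prop)] at this
    simp only [integral_map (hmeX _) g.continuous.aestronglyMeasurable, hgf] at this
    exact this

end Moments

/-! ### Uniform pairs of maps and Poisson variables -/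

/-- Expectations over two independent uniform maps are averages over all pairs of maps. -/
theorem integrable_and_integral_uniform_pair {n : ℕ} {Ω : Type*} [MeasurableSpace Ω]
    {P : Measure Ω} [IsProbabilityMeasure P] {A B : Ω → Fin n → Fin n}
    (hA : HasLaw A (uniformOn Set.univ) P) (hB : HasLaw B (uniformOn Set.univ) P)
    (hAB : IndepFun A B P) (φ : (Fin n → Fin n) → (Fin n → Fin n) → ℝ) :
    Integrable (fun ω => φ (A ω) (B ω)) P ∧
      ∫ ω, φ (A ω) (B ω) ∂P = (∑ F : Letter × Fin n → Fin n,
        φ (fun x => F (Letter.a, x)) (fun x => F (Letter.b, x))) / (n : ℝ) ^ (2 * n) := by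
  have hm : AEMeasurable (fun ω => (A ω, B ω)) P := hA.aemeasurable.prodMk hB.aemeasurable
  have hmap := (indepFun_iff_map_prod_eq_prod_map_map hA.aemeasurable hB.aemeasurable).mp hAB
  rw [hA.map_eq, hB.map_eq] at hmap
  have hne : Nonempty (Fin n → Fin n) := ⟨id⟩
  set ψ : (Fin n → Fin n) × (Fin n → Fin n) → ℝ := fun q => φ q.1 q.2 with hψ
  have hint : Integrable ψ (P.map fun ω => (A ω, B ω)) := by
    rw [hmap]; exact Integrable.of_finite
  refine ⟨hint.comp_aemeasurable hm, ?_⟩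
  have h1 : ∫ ω, φ (A ω) (B ω) ∂P = ∫ q, ψ q ∂(P.map fun ω => (A ω, B ω)) :=
    (integral_map (f := ψ) hm .of_discrete).symm
  rw [h1, integral_fintype hint, hmap, Finset.sum_div]
  have hatom : ∀ f : Fin n → Fin n,
      (uniformOn (Set.univ : Set (Fin n → Fin n))).real {f} = 1 / (n : ℝ) ^ n := by
    intro f
    rw [measureReal_def, uniformOn_univ, Measure.count_singleton]
    simp
  let e : (Letter × Fin n → Fin n) ≃ (Fin n → Fin n) × (Fin n → Fin n) :=
    { toFun := fun F => (fun x => F (Letter.a, x), fun x => F (Letter.b, x))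
      invFun := fun q z => letterMap q.1 q.2 z.1 z.2
      left_inv := fun F => by funext ⟨l, x⟩; cases l <;> rfl
      right_inv := fun q => rfl }
  rw [← e.sum_comp]
  refine Finset.sum_congr rfl fun F _ => ?_
  rw [← Set.singleton_prod_singleton (a := (e F).1) (b := (e F).2), measureReal_prod_prod, hatom,
    hatom, smul_eq_mul]
  change 1 / (n : ℝ) ^ n * (1 / (n : ℝ) ^ n) *
    φ (fun x => F (Letter.a, x)) (fun x => F (Letter.b, x)) = _
  rw [two_mul, pow_add]
  ring

theorem aemeasurable_pair_comp {n : ℕ} {Ω E : Type*} [MeasurableSpace Ω] [MeasurableSpace E]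
    {P : Measure Ω} {A B : Ω → Fin n → Fin n} (hA : AEMeasurable A P) (hB : AEMeasurable B P)
    (φ : (Fin n → Fin n) → (Fin n → Fin n) → E) : AEMeasurable (fun ω => φ (A ω) (B ω)) P :=
  have h : Measurable (fun q : (Fin n → Fin n) × (Fin n → Fin n) => φ q.1 q.2) := .of_discrete
  h.comp_aemeasurable (hA.prodMk hB)

/-- The terms with `m < r` vanish. Shifting by `r` cancels the falling factorial against the
factorial and leaves `lam ^ r` times the total Poisson mass. -/
theorem hasSum_poisson_descFactorial (lam : NNReal) (r : ℕ) :
    HasSum (fun m : ℕ => Real.exp (-lam) * (lam : ℝ) ^ m / (m.factorial : ℝ) *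
      (m.descFactorial r : ℝ)) ((lam : ℝ) ^ r) := by
  have h := (hasSum_one_poissonMeasure lam).mul_left ((lam : ℝ) ^ r)
  rw [mul_one] at h
  rw [← (add_left_injective r).hasSum_iff]
  · refine h.congr_fun fun m => ?_
    have hfac : (m.factorial : ℝ) * ((m + r).descFactorial r : ℝ) = ((m + r).factorial : ℝ) := by
      have := Nat.factorial_mul_descFactorial (Nat.le_add_left r m)
      rw [Nat.add_sub_cancel] at this
      exact_mod_cast this
    have h1 : (m.factorial : ℝ) ≠ 0 := by positivity
    have h2 : ((m + r).factorial : ℝ) ≠ 0 := by positivity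
    simp only [Function.comp_apply]
    rw [div_mul_eq_mul_div, mul_div_assoc', div_eq_div_iff h2 h1, ← hfac, pow_add]
    ring
  · intro m hm
    have : m < r := by
      by_contra! h
      exact hm ⟨m - r, Nat.sub_add_cancel h⟩
    rw [Nat.descFactorial_of_lt this]
    simp

theorem integrable_poisson_descFactorial (lam : NNReal) (r : ℕ) :
    Integrable (fun m : ℕ => (m.descFactorial r : ℝ)) (poissonMeasure lam) := by
  rw [integrable_poissonMeasure_iff]
  simp only [Real.norm_natCast]
  exact (hasSum_poisson_descFactorial lam r).summable

theorem integral_poisson_descFactorial (lam : NNReal) (r : ℕ) :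
    ∫ m : ℕ, (m.descFactorial r : ℝ) ∂(poissonMeasure lam) = (lam : ℝ) ^ r := by
  rw [integral_poissonMeasure]
  simp only [smul_eq_mul]
  exact (hasSum_poisson_descFactorial lam r).tsum_eq

/-- Up to the factor `exp (-lam)`, the series is the exponential series at `lam * exp c`. -/
theorem integrable_poisson_exp (lam : NNReal) (c : ℝ) :
    Integrable (fun m : ℕ => Real.exp (c * m)) (poissonMeasure lam) := by
  rw [integrable_poissonMeasure_iff]
  have := (Real.summable_pow_div_factorial (lam * Real.exp c)).mul_left (Real.exp (-lam))
  refine this.congr fun m => ?_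
  rw [Real.norm_of_nonneg (Real.exp_pos _).le, mul_pow, ← Real.exp_nat_mul, mul_comm c]
  ring

theorem integrable_prod_of_iIndepFun {ι Ω : Type*} [Fintype ι] [MeasurableSpace Ω]
    {P : Measure Ω} [IsProbabilityMeasure P] {Z : ι → Ω → ℕ} {ν : ι → Measure ℕ}
    (hZ : ∀ i, HasLaw (Z i) (ν i) P) (hind : iIndepFun Z P) {f : ι → ℕ → ℝ}
    (hf : ∀ i, Integrable (f i) (ν i)) :
    Integrable (fun ω => ∏ i, f i (Z i ω)) P := by
  have hν : ∀ i, IsProbabilityMeasure (ν i) := fun i => by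
    rw [← (hZ i).map_eq]; exact Measure.isProbabilityMeasure_map (hZ i).aemeasurable
  have hm : ∀ i, AEMeasurable (Z i) P := fun i => (hZ i).aemeasurable
  have hmap := (iIndepFun_iff_map_fun_eq_pi_map hm).mp hind
  simp only [fun i => (hZ i).map_eq] at hmap
  have h1 : Integrable (fun x : ι → ℕ => ∏ i, f i (x i)) (P.map fun ω i => Z i ω) := by
    rw [hmap]; exact Integrable.fintype_prod hf
  exact h1.comp_aemeasurable (aemeasurable_pi_lambda _ hm)

theorem integral_prod_of_iIndepFun {ι Ω : Type*} [Fintype ι] [MeasurableSpace Ω]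
    {P : Measure Ω} [IsProbabilityMeasure P] {Z : ι → Ω → ℕ} {ν : ι → Measure ℕ}
    (hZ : ∀ i, HasLaw (Z i) (ν i) P) (hind : iIndepFun Z P) (f : ι → ℕ → ℝ) :
    ∫ ω, ∏ i, f i (Z i ω) ∂P = ∏ i, ∫ m, f i m ∂(ν i) := by
  rw [hind.integral_fun_prod_comp (fun i => (hZ i).aemeasurable) fun i => .of_discrete]
  exact Finset.prod_congr rfl fun i _ => (hZ i).integral_comp (f := f i) .of_discrete

/-! ### Convergence of the cycle vectors -/

section Main

variable {Ω : ℕ → Type*} [∀ n, MeasurableSpace (Ω n)]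
    {P : (n : ℕ) → Measure (Ω n)} [∀ n, IsProbabilityMeasure (P n)]
    {A B : (n : ℕ) → Ω n → Fin n → Fin n}
    {Ω' : Type*} [MeasurableSpace Ω'] {P' : Measure Ω'} [IsProbabilityMeasure P']
    {Z : ℕ → Ω' → ℕ}

theorem tendstoInMoments_cycleVector
    (hA : ∀ n, HasLaw (A n) (uniformOn Set.univ) (P n))
    (hB : ∀ n, HasLaw (B n) (uniformOn Set.univ) (P n))
    (hAB : ∀ n, IndepFun (A n) (B n) (P n))
    {u : Word} (hu : IsPrimitive u) {L : ℕ}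
    (hZ : ∀ i : Finset.Icc 1 L, HasLaw (Z i) (poissonMeasure (1 / ((i : ℕ) : NNReal))) P')
    (hind : iIndepFun (fun (i : Finset.Icc 1 L) => Z i) P') :
    TendstoInMoments (fun n ω => cycleVector (wordMap (A n ω) (B n ω) u) L) P
      (fun ω (i : Finset.Icc 1 L) => Z i ω) P' := by
  refine tendstoInMoments_of_descFactorial fun r => ?_
  have hu' := fun n => integrable_and_integral_uniform_pair (hA n) (hB n) (hAB n)
    fun f g => ∏ l, ((cycleVector (wordMap f g u) L l).descFactorial (r l) : ℝ)
  refine ⟨fun n => (hu' n).1, integrable_prod_of_iIndepFun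
    (f := fun i m => (m.descFactorial (r i) : ℝ)) hZ hind
    (fun i => integrable_poisson_descFactorial _ _), ?_⟩
  rw [integral_prod_of_iIndepFun hZ hind fun i m => (m.descFactorial (r i) : ℝ)]
  simp only [fun n => (hu' n).2, integral_poisson_descFactorial]
  have := tendsto_mean_prod_descFactorial hu L r
  simpa using this

theorem tendstoInDistribution_cycleVector
    (hA : ∀ n, HasLaw (A n) (uniformOn Set.univ) (P n))
    (hB : ∀ n, HasLaw (B n) (uniformOn Set.univ) (P n))
    (hAB : ∀ n, IndepFun (A n) (B n) (P n))
    {u : Word} (hu : IsPrimitive u) {L : ℕ}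
    (hZ : ∀ i : Finset.Icc 1 L, HasLaw (Z i) (poissonMeasure (1 / ((i : ℕ) : NNReal))) P')
    (hind : iIndepFun (fun (i : Finset.Icc 1 L) => Z i) P') :
    TendstoInDistribution (fun n ω => cycleVector (wordMap (A n ω) (B n ω) u) L) atTop
      (fun ω (i : Finset.Icc 1 L) => Z i ω) P P' := by
  refine (tendstoInMoments_cycleVector hA hB hAB hu hZ hind).tendstoInDistribution
    (fun n => aemeasurable_pair_comp (hA n).aemeasurable (hB n).aemeasurable
      fun f g => cycleVector (wordMap f g u) L) (aemeasurable_pi_lambda _ fun i => (hZ i).aemeasurable)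
    fun c => ?_
  have := integrable_prod_of_iIndepFun (f := fun i m => Real.exp (c * m)) hZ hind
    (fun i => integrable_poisson_exp _ _)
  simpa only [← Real.exp_sum, ← Finset.mul_sum] using this

end Main

end RandomWordMap

theorem mainTheorem3
    {Ω : ℕ → Type*} [∀ n, MeasurableSpace (Ω n)]
    (P : (n : ℕ) → Measure (Ω n)) [∀ n, IsProbabilityMeasure (P n)]
    (A B : (n : ℕ) → Ω n → Fin n → Fin n)
    (hA : ∀ n, HasLaw (A n) (uniformOn Set.univ) (P n))
    (hB : ∀ n, HasLaw (B n) (uniformOn Set.univ) (P n))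
    (hAB : ∀ n, IndepFun (A n) (B n) (P n))
    {Ω' : Type*} [MeasurableSpace Ω'] (P' : Measure Ω') [IsProbabilityMeasure P']
    (Z : ℕ → Ω' → ℕ)
    (hZ : ∀ ℓ : ℕ, 1 ≤ ℓ → HasLaw (Z ℓ) (poissonMeasure (1 / (ℓ : NNReal))) P')
    (hZindep : iIndepFun (fun (ℓ : ℕ+) (ω : Ω') => Z (ℓ : ℕ) ω) P')
    (u w : RandomWordMap.Word) (d : ℕ) (hu : RandomWordMap.IsPrimitive u) (hd : 1 ≤ d)
    (hw : w = u ^ d) (L : ℕ) (hL : 1 ≤ L) :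
    (TendstoInDistribution
        (fun n ω => RandomWordMap.cycleVector (RandomWordMap.wordMap (A n ω) (B n ω) u) L) atTop
        (fun ω (i : Finset.Icc 1 L) => Z i ω) P P' ∧
      RandomWordMap.TendstoInMoments
        (fun n ω => RandomWordMap.cycleVector (RandomWordMap.wordMap (A n ω) (B n ω) u) L) P
        (fun ω (i : Finset.Icc 1 L) => Z i ω) P') ∧
    (TendstoInDistribution
        (fun n ω => RandomWordMap.cycleVector (RandomWordMap.wordMap (A n ω) (B n ω) w) L) atTop
        (fun ω => RandomWordMap.Psi d L (fun i => Z i ω)) P P' ∧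
      RandomWordMap.TendstoInMoments
        (fun n ω => RandomWordMap.cycleVector (RandomWordMap.wordMap (A n ω) (B n ω) w) L) P
        (fun ω => RandomWordMap.Psi d L (fun i => Z i ω)) P') := by
  have hZ' : ∀ (M : ℕ) (i : Finset.Icc 1 M),
      HasLaw (Z i) (poissonMeasure (1 / ((i : ℕ) : NNReal))) P' :=
    fun M i => hZ i (Finset.mem_Icc.mp i.2).1
  have hind : ∀ M : ℕ, iIndepFun (fun (i : Finset.Icc 1 M) => Z i) P' := fun M =>
    hZindep.precomp (g := fun i : Finset.Icc 1 M => (⟨(i : ℕ), (Finset.mem_Icc.mp i.2).1⟩ : ℕ+))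
      fun i j h => Subtype.ext (congrArg PNat.val h)
  refine ⟨⟨RandomWordMap.tendstoInDistribution_cycleVector hA hB hAB hu (hZ' L) (hind L),
    RandomWordMap.tendstoInMoments_cycleVector hA hB hAB hu (hZ' L) (hind L)⟩, ?_⟩
  subst hw
  -- The cycle vector of `w` is identically `Psi` of that of `u` up to length `d * L`. `Psi` is
  -- continuous because its domain is discrete, so the first part at `d * L` suffices.
  simp only [RandomWordMap.wordMap_pow, RandomWordMap.cycleVector_iterate _ hd]
  exact ⟨(RandomWordMap.tendstoInDistribution_cycleVector hA hB hAB hu (hZ' (d * L))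
      (hind (d * L))).continuous_comp (g := RandomWordMap.Psi d L) continuous_of_discreteTopology,
    (RandomWordMap.tendstoInMoments_cycleVector hA hB hAB hu (hZ' (d * L))
      (hind (d * L))).psi⟩
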